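/- Let $\Sigma$ be a finite alphabet. For $z:\mathbb N\to\mathbb R$ and finite alphabets $\Sigma,\Delta$, let $\mathrm{FDSPACE}[z(n)]$ denote the class of all functions $\Sigma^*\to\Delta^*$ that are computed by a deterministic Turing machine (with a read-only input tape, finitely many work tapes and a write-only output tape) that on every input of length $n$ halts and uses $O(z(n))$ work tape cells. Let $Q_{\log}$ be the set of all functions $\rho:\Sigma^*\to\mathbb N=\{0,1,2,\dots\}$ such that $\rho(I)=O(\log|I|)$ and (the binary representation of) $\rho(I)$ is computable from $I$ in space $O(\log|I|)$. For $f:\Sigma^*\to\Sigma^*$ let $f^0=\mathrm{id}$, $f^{i+1}=f\circ f^i$, and for $\rho\in Q_{\log}$ let $f^\rho$ be the function $I\mapsto f^{\rho(I)}(I)$. Let $\mathrm{FDSPACE}[\log n]_{\mathrm{pol}}$ be the class of all functions $f:\Sigma^*\to\Sigma^*$ in $\mathrm{FDSPACE}[\log n]$ for which there is a polynomial $\gamma$ with $|f^i(I)|\le\gamma(|I|)$ for all inputs $I\in\Sigma^*$ and all $i\ge 1$. Put $$[\![\mathrm{FDSPACE}[\log n]_{\mathrm{pol}}]\!]^{\log}=\{\,f^\rho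 : f\in \mathrm{FDSPACE}[\log n]_{\mathrm{pol}},\ \rho\in Q_{\log}\,\}.$$ Then $$[\![\mathrm{FDSPACE}[\log n]_{\mathrm{pol}}]\!]^{\log}\subseteq \mathrm{FDSPACE}[\log^2 n].$$ -/

import Mathlib

open Asymptotics Filter

namespace LogComp

/-- What the head of the read-only input tape can see: one of the two end markers
or a letter of the input word. -/
inductive InputSymbol (α : Type) where
  | leftEnd : InputSymbol α
  | letter : α → InputSymbol α
  | rightEnd : InputSymbol α

/-- Head movements of a Turing machine. -/
inductive Move where
  | left : Move
  | stay : Move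
  | right : Move

/-- The new position of a head on a tape that is infinite to the right only: a head on cell `0`
stays there when told to move left. -/
def Move.apply : Move → ℕ → ℕ
  | .left, p => p - 1
  | .stay, p => p
  | .right, p => p + 1

/-- What a Turing machine transducer does in one step: enter a new state, move the input head,
write one symbol on each work tape and then move the head of that tape, and append at most one
letter to the output. -/
structure Action (State Tape Symbol β : Type) where
  state : State
  moveInput : Move
  write : Tape → Symbol
  moveWork : Tape → Move
  emit : Option β

/-- A deterministic multitape Turing machine transducer with input alphabet `α` and output
alphabet `β`. It has a two-way read-only input tape with end markers, finitely many read/write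
work tapes, and a one-way write-only output tape. It halts when `next` is `none`. -/
structure Transducer (α β : Type) where
  State : Type
  Tape : Type
  Symbol : Type
  finiteState : Finite State
  finiteTape : Finite Tape
  finiteSymbol : Finite Symbol
  start : State
  blank : Symbol
  next : State → InputSymbol α → (Tape → Symbol) → Option (Action State Tape Symbol β)

namespace Transducer

variable {α β : Type}

/-- A configuration of the machine (the input word is kept outside, since it never changes). -/
structure Cfg (M : Transducer α β) where
  state : M.State
  inputPos : ℕ
  work : M.Tape → ℕ → M.Symbol
  workPos : M.Tape → ℕ
  output : List β

/-- The content of the cell `p` of the input tape on input `x`: cell `0` holds the left end marker,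
cells `1, …, |x|` hold the letters of `x`, and cell `|x| + 1` holds the right end marker. -/
def inputAt (x : List α) : ℕ → InputSymbol α
  | 0 => .leftEnd
  | p + 1 => match x[p]? with
    | some a => .letter a
    | none => .rightEnd

/-- The initial configuration: all work tapes blank, all heads on cell `0`, empty output. -/
def init (M : Transducer α β) : M.Cfg where
  state := M.start
  inputPos := 0
  work := fun _ _ => M.blank
  workPos := fun _ => 0
  output := []

/-- One step of the machine on input `x`; `none` if the machine has halted.
The input head never leaves the cells `0, …, |x| + 1`. -/
def step (M : Transducer α β) (x : List α) (c : M.Cfg) : Option M.Cfg :=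
  (M.next c.state (inputAt x c.inputPos) (fun t => c.work t (c.workPos t))).map fun a =>
    { state := a.state
      inputPos := min (a.moveInput.apply c.inputPos) (x.length + 1)
      work := fun t => Function.update (c.work t) (c.workPos t) (a.write t)
      workPos := fun t => (a.moveWork t).apply (c.workPos t)
      output := c.output ++ a.emit.toList }

/-- On input `x` the machine halts with output `y`. -/
def Outputs (M : Transducer α β) (x : List α) (y : List β) : Prop :=
  ∃ c : M.Cfg, StateTransition.Reaches (M.step x) M.init c ∧ M.step x c = none ∧ c.output = y

/-- On input `x` the machine never visits a cell outside the first `s` cells of any of its work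
tapes. Input tape and output tape do not count. The number of work tapes is a constant of the
machine, so it is immaterial for `O`-bounds whether cells are counted per tape or in total. -/
def SpaceAtMost (M : Transducer α β) (x : List α) (s : ℕ) : Prop :=
  ∀ c : M.Cfg, StateTransition.Reaches (M.step x) M.init c → ∀ t : M.Tape, c.workPos t < s

end Transducer

/-- `FDSPACE[z(n)]`: the functions from words over `α` to words over `β` that are computed by some
deterministic Turing machine transducer in space `O(z(n))`, where `n` is the input length. -/
def FDSPACE (α β : Type) (z : ℕ → ℝ) : Set (List α → List β) :=
  {f | ∃ (M : Transducer α β) (s : ℕ → ℕ),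
    (fun n => (s n : ℝ)) =O[atTop] z ∧
      ∀ x : List α, M.Outputs x (f x) ∧ M.SpaceAtMost x (s x.length)}

/-- `Q_log`: the functions `ρ` from words to natural numbers with `ρ(x) = O(log |x|)` such that
(the binary representation of) `ρ(x)` is computable from `x` in logarithmic space. -/
def QLog (α : Type) : Set (List α → ℕ) :=
  {ρ | (fun x : List α => (ρ x : ℝ)) =O[comap List.length atTop]
        (fun x : List α => Real.log x.length) ∧
      (fun x : List α => Nat.bits (ρ x)) ∈ FDSPACE α Bool (fun n => Real.log n)}

/-- `C_pol`: the functions `f` in `C` all of whose iterates have output length bounded by one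
fixed polynomial in the input length. -/
def polClass {α : Type} (C : Set (List α → List α)) : Set (List α → List α) :=
  {f | f ∈ C ∧ ∃ γ : Polynomial ℕ, ∀ (x : List α) (i : ℕ), 1 ≤ i →
    (f^[i] x).length ≤ γ.eval x.length}

/-- `f ^ ρ`, the function that maps `x` to `f ^ (ρ x)` applied to `x`. -/
def iterateBy {α : Type} (f : List α → List α) (ρ : List α → ℕ) : List α → List α :=
  fun x => f^[ρ x] x

/-- `[[C]]^log`: the functions `f ^ ρ` with `f` in `C` and `ρ` in `Q_log`. -/
def logCompositions {α : Type} (C : Set (List α → List α)) : Set (List α → List α) :=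
  {g | ∃ f ∈ C, ∃ ρ ∈ QLog α, g = iterateBy f ρ}

end LogComp

/-! Write $Y_k=f^k(x)$. The words $Y_k$ have polynomial length and do not fit into the allowed
space, so their letters are recomputed on demand. To find the letter of $Y_{k+1}$ at a given
position, the machine $M$ for $f$ is run from its start on the virtual input $Y_k$, and the output
letters before that position are dropped. Whenever $M$ looks at its input, the run is suspended and
the letter of $Y_k$ under its head is found in the same way; the letters of $Y_0=x$ are on the real
input tape.

At any time there is at most one run per level. It is described by its state, the contents of its
work tapes, its input position and the number of letters still to be dropped. As all $|Y_k|$ are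
bounded by one polynomial in $n=|x|$, this takes $O(\log n)$ cells, and a stack of $O(\log n)$ such
records takes $O(\log^2 n)$.

The machine is built explicitly, from operations that each act on one tape; `Program.Reach.computes`
transfers correctness and space from such programs to Turing machines. The recursion invariant is
`CallSpec`: a call delivers the right symbol and restores all stacks. `leads_run` proves one level
by induction along the run of $M$, and `callSpec` follows by induction on the level. `computes` adds
the computation of $\rho(x)$ and the printing of the result, and `exists_logBound_eval_le` turns
polynomial lengths into logarithmic counters. -/

namespace LogComp

/-! ### Tapes as pairs of lists. -/

/-- A tape with a head: the cells to the left of the head, the nearest one first, and the cells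
from the head on to the right. All further cells are blank. -/
structure Zip (A : Type) where
  left : List A
  right : List A

namespace Zip

variable {A : Type}

/-- The content of the cell under the head, where `b` is the blank symbol. -/
def read (b : A) (z : Zip A) : A := z.right.headD b

/-- The content of the cell `i`, where `b` is the blank symbol. -/
def cell (b : A) (z : Zip A) (i : ℕ) : A := (z.left.reverse ++ z.right).getD i b

/-- Write `a` and move the head. The function `push` prepends a symbol to the list of cells. -/
def act (push : A → List A → List A) (a : A) : Move → Zip A → Zip A
  | .stay, z => ⟨z.left, push a z.right.tail⟩
  | .right, z => ⟨a :: z.left, z.right.tail⟩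
  | .left, ⟨[], r⟩ => ⟨[], push a r.tail⟩
  | .left, ⟨c :: l, r⟩ => ⟨l, push c (push a r.tail)⟩

theorem cell_left_length (b : A) (z : Zip A) : z.cell b z.left.length = z.read b := by
  obtain ⟨l, r⟩ := z
  cases r <;> simp [cell, read]

theorem left_length_act (push : A → List A → List A) (a : A) (m : Move) (z : Zip A) :
    (z.act push a m).left.length = m.apply z.left.length := by
  obtain ⟨l, r⟩ := z
  cases m <;> cases l <;> simp [act, Move.apply]

theorem getD_append_eq (l r : List A) (i : ℕ) (b : A) :
    (l ++ r).getD i b = if i < l.length then l.getD i b else r.getD (i - l.length) b := by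
  split_ifs with h
  · exact List.getD_append _ _ _ _ h
  · exact List.getD_append_right _ _ _ _ (by omega)

theorem getD_cons_tail (a b : A) (r : List A) (i : ℕ) :
    (a :: r.tail).getD i b = if i = 0 then a else r.getD i b := by
  cases i <;> cases r <;> simp

/-- Only the contents up to blank padding matter, so `push` may be `List.cons` (for the simulated
tapes) as well as `optCons` (for the tapes of the program). -/
theorem cell_act {push : A → List A → List A} {b : A}
    (hp : ∀ a r i, (push a r).getD i b = (a :: r).getD i b) (a : A) (m : Move) (z : Zip A) :
    (z.act push a m).cell b = Function.update (z.cell b) z.left.length a := by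
  obtain ⟨l, r⟩ := z
  have key : ∀ i, (l.reverse ++ a :: r.tail).getD i b =
      Function.update (cell b ⟨l, r⟩) l.length a i := by
    intro i
    rw [getD_append_eq, Function.update_apply]
    simp only [cell, getD_append_eq, List.length_reverse, getD_cons_tail]
    split_ifs <;> first | rfl | omega
  have tail_congr : ∀ (l u v : List A), (∀ j, u.getD j b = v.getD j b) →
      ∀ i, (l ++ u).getD i b = (l ++ v).getD i b := by
    intro l u v h i
    rw [getD_append_eq, getD_append_eq, h]
  funext i
  rw [← key]
  cases m with
  | stay => exact tail_congr _ _ _ (hp _ _) i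
  | right => simp [act, cell]
  | left =>
    cases l with
    | nil => exact tail_congr [] _ _ (hp _ _) i
    | cons c l =>
      rw [List.reverse_cons, List.append_assoc]
      refine tail_congr _ _ _ (fun j => ?_) i
      refine (hp _ _ _).trans ?_
      exact tail_congr [c] _ _ (hp _ _) j

end Zip

/-- Prepend a symbol to a list of cells, unless the list is empty and the symbol blank. -/
def optCons {A : Type} : Option A → List (Option A) → List (Option A)
  | none, [] => []
  | a, r => a :: r

@[simp] theorem optCons_some {A : Type} (a : A) (r : List (Option A)) :
    optCons (some a) r = some a :: r := by
  cases r <;> rfl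

@[simp] theorem optCons_none_nil {A : Type} : optCons (none : Option A) [] = [] := rfl

theorem optCons_getD {A : Type} (a : Option A) (r : List (Option A)) (i : ℕ) :
    (optCons a r).getD i none = (a :: r).getD i none := by
  cases a <;> cases r <;> cases i <;> simp [optCons]

/-! ### Space-bounded runs of a machine. -/

namespace Transducer

variable {α β : Type} (M : Transducer α β)

/-- A run on input `x` on which the heads of all work tapes are on the first `s` cells before
every step. -/
def BoundedReach (x : List α) (s : ℕ) : M.Cfg → M.Cfg → Prop :=
  Relation.ReflTransGen fun c d => M.step x c = some d ∧ ∀ t, c.workPos t < s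

variable {M}

theorem BoundedReach.reaches {x : List α} {s : ℕ} {c d : M.Cfg} (h : M.BoundedReach x s c d) :
    StateTransition.Reaches (M.step x) c d :=
  Relation.ReflTransGen.mono (fun _ _ h => h.1) _ _ h

/-- The machine is deterministic, so every reachable configuration lies on the one halting run, and
a space bound along that run is a bound for all of them. -/
theorem BoundedReach.workPos_lt {x : List α} {s : ℕ} {c d : M.Cfg} (h : M.BoundedReach x s c d)
    (hd : M.step x d = none) (hs : ∀ t, d.workPos t < s) {e : M.Cfg}
    (he : StateTransition.Reaches (M.step x) c e) (t : M.Tape) : e.workPos t < s := by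
  induction h using Relation.ReflTransGen.head_induction_on with
  | refl =>
    cases he.cases_head with
    | inl h => exact h ▸ hs t
    | inr h => obtain ⟨f, hf, -⟩ := h; simp [hd] at hf
  | head h _ ih =>
    cases he.cases_head with
    | inl h' => exact h' ▸ h.2 t
    | inr h' =>
      obtain ⟨f, hf, hfe⟩ := h'
      rw [h.1] at hf
      cases hf
      exact ih hfe

theorem BoundedReach.computes {x : List α} {s : ℕ} {d : M.Cfg}
    (h : M.BoundedReach x s M.init d) (hd : M.step x d = none) (hs : ∀ t, d.workPos t < s) :
    M.Outputs x d.output ∧ M.SpaceAtMost x s :=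
  ⟨⟨d, h.reaches, hd, rfl⟩, fun _ he t => h.workPos_lt hd hs he t⟩

end Transducer

/-! ### Operations on single tapes, programs, and their execution by Turing machines. -/

/-- One step of an operation that may be completed already. -/
def microStep {Op Symbol : Type} (micro : Op → Option Symbol → Option Op × Option Symbol × Move) :
    Option Op → Option Symbol → Option Op × Option Symbol × Move
  | none, g => (none, g, .stay)
  | some o, g => micro o g

/-- `Exec micro s o z z'`: the operation `o` transforms the tape `z` into `z'` without leaving
the first `s` cells. A single step is given by `micro`. -/
inductive Exec {Op Symbol : Type}
    (micro : Op → Option Symbol → Option Op × Option Symbol × Move) (s : ℕ) :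
    Option Op → Zip (Option Symbol) → Zip (Option Symbol) → Prop
  | done {z} (h : z.left.length < s) : Exec micro s none z z
  | step {o z z'} (h : z.left.length < s)
      (h' : Exec micro s (micro o (z.read none)).1
        (z.act optCons (micro o (z.read none)).2.1 (micro o (z.read none)).2.2) z') :
      Exec micro s (some o) z z'

/-- Execution within a given number of steps. -/
inductive ExecIn {Op Symbol : Type}
    (micro : Op → Option Symbol → Option Op × Option Symbol × Move) (s : ℕ) :
    ℕ → Option Op → Zip (Option Symbol) → Zip (Option Symbol) → Prop
  | done {n z} (h : z.left.length < s) : ExecIn micro s n none z z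
  | step {n o z z'} (h : z.left.length < s)
      (h' : ExecIn micro s n (micro o (z.read none)).1
        (z.act optCons (micro o (z.read none)).2.1 (micro o (z.read none)).2.2) z') :
      ExecIn micro s (n + 1) (some o) z z'

section Exec

variable {Op Symbol : Type} {micro : Op → Option Symbol → Option Op × Option Symbol × Move}
  {s n m : ℕ} {o : Option Op} {z z' : Zip (Option Symbol)}

theorem Exec.left_lt (h : Exec micro s o z z') : z.left.length < s := by
  cases h <;> assumption

theorem Exec.left_lt' (h : Exec micro s o z z') : z'.left.length < s := by
  induction h <;> assumption

theorem ExecIn.mono (h : ExecIn micro s n o z z') (hm : n ≤ m) : ExecIn micro s m o z z' := by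
  induction h generalizing m with
  | done h => exact .done h
  | step h _ ih =>
    obtain ⟨k, rfl⟩ : ∃ k, m = k + 1 := ⟨m - 1, by omega⟩
    exact .step h (ih (by omega))

theorem Exec.execIn (h : Exec micro s o z z') : ∃ n, ExecIn micro s n o z z' := by
  induction h with
  | done h => exact ⟨0, .done h⟩
  | step h _ ih => obtain ⟨n, hn⟩ := ih; exact ⟨n + 1, .step h hn⟩

theorem ExecIn.eq_of_none (h : ExecIn micro s n none z z') : z = z' := by
  cases h; rfl

theorem ExecIn.left_lt (h : ExecIn micro s n o z z') : z.left.length < s := by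
  cases h <;> assumption

/-- A completed operation idles by rewriting the symbol it reads, so one unit of the step budget can
be used up on all tapes simultaneously. -/
theorem ExecIn.microStep (h : ExecIn micro s (n + 1) o z z') :
    ∃ z1, ExecIn micro s n (microStep micro o (z.read none)).1 z1 z' ∧
      z1.cell none = Function.update (z.cell none) z.left.length
        (LogComp.microStep micro o (z.read none)).2.1 ∧
      z1.left.length =
        (LogComp.microStep micro o (z.read none)).2.2.apply z.left.length := by
  cases h with
  | done h =>
    refine ⟨_, .done h, ?_, rfl⟩
    simp [LogComp.microStep, ← Zip.cell_left_length]
  | step h h' => exact ⟨_, h', Zip.cell_act optCons_getD _ _ _, Zip.left_length_act _ _ _ _⟩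

end Exec

/-- A command of a program: enter a new state, move the input head, start an operation on each
work tape (or none), and append at most one letter to the output. -/
structure Command (State Tape Op β : Type) where
  state : State
  moveInput : Move
  ops : Tape → Option Op
  emit : Option β

/-- A program is a Turing machine transducer whose elementary actions on work tapes are
operations of several steps, each of which deals with one tape only. Operations on different
tapes run in parallel; the next command is executed when all of them are completed.
The blank symbol is `none`. -/
structure Program (α β : Type) where
  State : Type
  Tape : Type
  Symbol : Type
  Op : Type
  finiteState : Finite State
  finiteTape : Finite Tape
  finiteSymbol : Finite Symbol
  finiteOp : Finite Op
  start : State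
  next : State → InputSymbol α → (Tape → Option Symbol) → Option (Command State Tape Op β)
  micro : Op → Option Symbol → Option Op × Option Symbol × Move

namespace Program

variable {α β : Type} (p : Program α β)

open Classical in
/-- The Turing machine that executes a program. -/
noncomputable def toTransducer : Transducer α β where
  State := p.State × (p.Tape → Option p.Op)
  Tape := p.Tape
  Symbol := Option p.Symbol
  finiteState := by
    have := p.finiteState; have := p.finiteTape; have := p.finiteOp; infer_instance
  finiteTape := p.finiteTape
  finiteSymbol := by have := p.finiteSymbol; infer_instance
  start := (p.start, fun _ => none)
  blank := none
  next := fun q i g =>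
    if ∀ t, q.2 t = none then
      (p.next q.1 i g).map fun a => ⟨(a.state, a.ops), a.moveInput, g, fun _ => .stay, a.emit⟩
    else
      some ⟨(q.1, fun t => (microStep p.micro (q.2 t) (g t)).1), .stay,
        fun t => (microStep p.micro (q.2 t) (g t)).2.1,
        fun t => (microStep p.micro (q.2 t) (g t)).2.2, none⟩

/-- A configuration of a program in between two commands. -/
structure Cfg where
  state : p.State
  inputPos : ℕ
  tapes : p.Tape → Zip (Option p.Symbol)
  output : List β

/-- The initial configuration. -/
def init : p.Cfg where
  state := p.start
  inputPos := 0
  tapes := fun _ => ⟨[], []⟩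
  output := []

/-- Execution of a single command. -/
def Step (x : List α) (s : ℕ) (c d : p.Cfg) : Prop :=
  ∃ a, p.next c.state (Transducer.inputAt x c.inputPos) (fun t => (c.tapes t).read none) = some a ∧
    d.state = a.state ∧ d.inputPos = min (a.moveInput.apply c.inputPos) (x.length + 1) ∧
    d.output = c.output ++ a.emit.toList ∧ ∀ t, Exec p.micro s (a.ops t) (c.tapes t) (d.tapes t)

/-- Execution of any number of commands. -/
def Reach (x : List α) (s : ℕ) : p.Cfg → p.Cfg → Prop := Relation.ReflTransGen (p.Step x s)

/-- The configuration of the Turing machine that executes a program while operations are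
running. -/
def Cfg.toCfg {p : Program α β} (c : p.Cfg) (o : p.Tape → Option p.Op) : p.toTransducer.Cfg where
  state := (c.state, o)
  inputPos := c.inputPos
  work := fun t => (c.tapes t).cell none
  workPos := fun t => (c.tapes t).left.length
  output := c.output

variable {p}

/-- The common step bound `n` makes an induction possible although the operations on different tapes
take different times: the faster ones wait for the slowest. -/
theorem boundedReach_of_execIn {x : List α} {s n : ℕ} {q : p.State} {i : ℕ} {y : List β}
    (hi : i ≤ x.length + 1) {o : p.Tape → Option p.Op} {z z' : p.Tape → Zip (Option p.Symbol)}
    (h : ∀ t, ExecIn p.micro s n (o t) (z t) (z' t)) :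
    p.toTransducer.BoundedReach x s (Cfg.toCfg ⟨q, i, z, y⟩ o)
      (Cfg.toCfg ⟨q, i, z', y⟩ fun _ => none) := by
  induction n generalizing o z with
  | zero =>
    have ho : o = fun _ => none := by
      funext t
      cases ho : o t with
      | none => rfl
      | some o' => have := h t; rw [ho] at this; nomatch this
    have hz : z = z' := by
      funext t; have := h t; rw [ho] at this; exact this.eq_of_none
    rw [ho, hz]
    exact .refl
  | succ n ih =>
    -- When every operation is complete, the machine would go on to the next command, so the rest of
    -- the budget is dropped.
    by_cases ho : ∀ t, o t = none
    · have hz : z = z' := by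
        funext t; have := h t; rw [ho] at this; exact this.eq_of_none
      obtain rfl : o = fun _ => none := funext ho
      rw [hz]
      exact .refl
    · choose z1 hz1 hc hl using fun t => (h t).microStep
      refine .head ⟨?_, fun t => (h t).left_lt⟩ (ih hz1)
      simp only [Transducer.step, toTransducer, Cfg.toCfg, if_neg ho, Option.map_some,
        Option.some.injEq, Zip.cell_left_length, hc, hl]
      simp [Move.apply, hi]

theorem Step.boundedReach {x : List α} {s : ℕ} {c d : p.Cfg} (h : p.Step x s c d) :
    p.toTransducer.BoundedReach x s (c.toCfg fun _ => none) (d.toCfg fun _ => none) := by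
  obtain ⟨a, ha, h1, h2, h3, h4⟩ := h
  choose n hn using fun t => (h4 t).execIn
  have := p.finiteTape
  -- There are finitely many tapes, hence a common bound for the durations of their operations.
  obtain ⟨m, hm⟩ := (Set.finite_range n).bddAbove
  have hm' : ∀ t, ExecIn p.micro s m (a.ops t) (c.tapes t) (d.tapes t) :=
    fun t => (hn t).mono (hm ⟨t, rfl⟩)
  refine .head (b := Cfg.toCfg ⟨d.state, d.inputPos, c.tapes, d.output⟩ a.ops)
    ⟨?_, fun t => (h4 t).left_lt⟩ (boundedReach_of_execIn (h2 ▸ min_le_right _ _) hm')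
  simp only [Transducer.step, toTransducer, Cfg.toCfg, Zip.cell_left_length, implies_true,
    if_true, ha, h1, h2, h3, Option.map_some]
  congr 2
  funext t
  rw [← Zip.cell_left_length, Function.update_eq_self]

theorem Reach.boundedReach {x : List α} {s : ℕ} {c d : p.Cfg} (h : p.Reach x s c d) :
    p.toTransducer.BoundedReach x s (c.toCfg fun _ => none) (d.toCfg fun _ => none) := by
  induction h with
  | refl => exact .refl
  | tail _ h ih => exact Relation.ReflTransGen.trans ih h.boundedReach

theorem Reach.computes {x : List α} {s : ℕ} {c : p.Cfg} (h : p.Reach x s p.init c)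
    (hc : p.next c.state (Transducer.inputAt x c.inputPos) (fun t => (c.tapes t).read none) = none)
    (hs : ∀ t, (c.tapes t).left.length < s) :
    p.toTransducer.Outputs x c.output ∧ p.toTransducer.SpaceAtMost x s := by
  have hi : p.init.toCfg (fun _ => none) = p.toTransducer.init := by
    simp [Cfg.toCfg, init, Transducer.init, toTransducer]
    funext t i
    simp [Zip.cell]
  refine Transducer.BoundedReach.computes (d := c.toCfg fun _ => none) (hi ▸ h.boundedReach) ?_ hs
  simp [Transducer.step, toTransducer, Cfg.toCfg, Zip.cell_left_length, hc]

end Program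

/-! ### Stacks of segments and binary counters on a tape. -/

/-- The symbols on the work tapes of the program that iterates a transducer. Here `A` and `Q` are
the symbols and the states of that transducer, and `B` the symbols of the transducer that computes
the number of iterations. -/
inductive Cell (A B Q : Type) where
  | delim : Cell A B Q
  | bit : Bool → Cell A B Q
  | sym : A → Cell A B Q
  | marked : Option A → Cell A B Q
  | caller : Q → Cell A B Q
  | level : Cell A B Q
  | aux : B → Cell A B Q

instance (A B Q : Type) [Finite A] [Finite B] [Finite Q] : Finite (Cell A B Q) := by
  rw [← Set.finite_univ_iff]
  refine (Set.toFinite (Set.range Cell.bit ∪ Set.range Cell.sym ∪ Set.range Cell.marked ∪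
    Set.range Cell.caller ∪ Set.range Cell.aux ∪ {Cell.delim, Cell.level})).subset ?_
  rintro (_ | _ | _ | _ | _ | _ | _) - <;> simp

/-- The operations on a single work tape. Tapes are stacks of segments that begin with `delim`;
counters are segments that hold a number in binary, the least significant bit first.
* `put` and `move` are single steps;
* `write` is a step that stays within the segment, with the help of `bounce`;
* `mark` marks the head position and opens a new segment, `seek` just opens a new segment;
* `erase` removes the last segment and returns to the marked position (if the argument is `true`)
  or to the beginning of the segment below (if it is `false`), using `clear` and `unmark`;
* `home` goes to the beginning of the segment;
* `inc` and `dec` change the counter in the segment by one, with the help of `borrow`;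
* `find` goes to the first nonzero bit of the counter. -/
inductive Op (Γ : Type) where
  | put : Option Γ → Move → Op Γ
  | move : Move → Op Γ
  | write : Option Γ → Move → Op Γ
  | bounce : Op Γ
  | mark : Op Γ
  | seek : Op Γ
  | erase : Bool → Op Γ
  | clear : Bool → Op Γ
  | unmark : Op Γ
  | home : Op Γ
  | inc : Op Γ
  | dec : Op Γ
  | borrow : Op Γ
  | find : Op Γ

instance : Finite Move := by
  rw [← Set.finite_univ_iff]
  refine (Set.toFinite {Move.left, Move.stay, Move.right}).subset ?_
  rintro (_ | _ | _) - <;> simp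

instance (Γ : Type) [Finite Γ] : Finite (Op Γ) := by
  rw [← Set.finite_univ_iff]
  refine (Set.toFinite (Set.range (fun a : Option Γ × Move => Op.put a.1 a.2) ∪
    Set.range (fun a : Option Γ × Move => Op.write a.1 a.2) ∪ Set.range Op.move ∪
    Set.range Op.erase ∪ Set.range Op.clear ∪
    {.bounce, .mark, .seek, .unmark, .home, .inc, .dec, .borrow, .find})).subset ?_
  rintro (_ | _ | _ | _ | _ | _ | _ | _ | _ | _ | _ | _ | _ | _) - <;> simp

namespace Op

variable {A B Q : Type}

/-- A single step of an operation. -/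
def micro : Op (Cell A B Q) → Option (Cell A B Q) →
    Option (Op (Cell A B Q)) × Option (Cell A B Q) × Move
  | put g m, _ => (none, g, m)
  | move m, g => (none, g, m)
  | write g m, _ => (some bounce, g, m)
  | bounce, some .delim => (none, some .delim, .right)
  | bounce, g => (none, g, .stay)
  | mark, some (.sym a) => (some seek, some (.marked (some a)), .right)
  | mark, _ => (some seek, some (.marked none), .right)
  | seek, none => (none, some .delim, .right)
  | seek, some g => (some seek, some g, .right)
  | erase b, none => (some (clear b), none, .left)
  | erase b, some g => (some (erase b), some g, .right)
  | clear b, some .delim => (if b then some unmark else some home, none, .left)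
  | clear b, _ => (some (clear b), none, .left)
  | unmark, some (.marked a) => (none, a.map .sym, .stay)
  | unmark, g => (some unmark, g, .left)
  | home, some .delim => (none, some .delim, .right)
  | home, g => (some home, g, .left)
  | inc, some (.bit true) => (some inc, some (.bit false), .right)
  | inc, _ => (some home, some (.bit true), .stay)
  | dec, some (.bit true) => (some borrow, some (.bit false), .left)
  | dec, g => (some dec, g, .right)
  | borrow, some .delim => (none, some .delim, .right)
  | borrow, _ => (some borrow, some (.bit true), .left)
  | find, some (.bit false) => (some find, some (.bit false), .right)
  | find, g => (none, g, .stay)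

/-- No cell of the list is blank or contains `delim`. -/
def Solid (u : List (Option (Cell A B Q))) : Prop := ∀ c ∈ u, c ≠ none ∧ c ≠ some .delim

/-- The cells that hold given bits. -/
def bits (b : List Bool) : List (Option (Cell A B Q)) := b.map fun a => some (.bit a)

/-- The cells that hold given symbols. -/
def syms (r : List A) : List (Option (Cell A B Q)) := r.map fun a => some (.sym a)

/-- What is to the left of the new segment after the operation `mark`. -/
def pushed (l : List (Option (Cell A B Q))) : List A → List (Option (Cell A B Q))
  | [] => some (.marked none) :: l
  | a :: r => (syms r).reverse ++ some (.marked (some a)) :: l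

@[simp] theorem length_bits (b : List Bool) :
    (bits b : List (Option (Cell A B Q))).length = b.length := by simp [bits]

@[simp] theorem length_syms (r : List A) :
    (syms r : List (Option (Cell A B Q))).length = r.length := by simp [syms]

theorem length_pushed (l : List (Option (Cell A B Q))) (r : List A) :
    (pushed l r).length = max r.length 1 + l.length := by
  cases r <;> simp [pushed] <;> omega

@[simp] theorem bits_nil : (bits [] : List (Option (Cell A B Q))) = [] := rfl

@[simp] theorem bits_cons (a : Bool) (b : List Bool) :
    (bits (a :: b) : List (Option (Cell A B Q))) = some (.bit a) :: bits b := rfl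

@[simp] theorem bits_append (a b : List Bool) :
    (bits (a ++ b) : List (Option (Cell A B Q))) = bits a ++ bits b := by simp [bits]

theorem bits_reverse (b : List Bool) :
    (bits b.reverse : List (Option (Cell A B Q))) = (bits b).reverse := by simp [bits]

theorem solid_bits (b : List Bool) : Solid (bits b : List (Option (Cell A B Q))) := by
  intro c hc
  obtain ⟨x, -, rfl⟩ := List.mem_map.mp hc
  simp

theorem solid_syms (r : List A) : Solid (syms r : List (Option (Cell A B Q))) := by
  simp [Solid, syms]

theorem Solid.reverse {u : List (Option (Cell A B Q))} (h : Solid u) : Solid u.reverse :=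
  fun c hc => h c (List.mem_reverse.mp hc)

variable {s : ℕ} {o : Op (Cell A B Q)} {z : Zip (Option (Cell A B Q))}

/-- The head moves right and rewrites the cells it passes. -/
theorem exec_right (f : Option (Cell A B Q) → Option (Cell A B Q))
    {u l r : List (Option (Cell A B Q))}
    (ho : ∀ c ∈ u, micro o c = (some o, f c, .right))
    (h : Exec micro s (some o) ⟨(u.map f).reverse ++ l, r⟩ z) :
    Exec micro s (some o) ⟨l, u ++ r⟩ z := by
  induction u generalizing l with
  | nil => exact h
  | cons c u ih =>
    have hl := h.left_lt
    simp at hl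
    have hc := ho c (by simp)
    refine .step (by simp; omega) ?_
    have := ih (l := f c :: l) (fun c hc => ho c (by simp [hc])) (by simpa using h)
    simpa [Zip.read, Zip.act, hc] using this

theorem optCons_of_ne {a : Option (Cell A B Q)} (h : a ≠ none)
    (r : List (Option (Cell A B Q))) : optCons a r = a :: r := by
  cases a with
  | none => exact absurd rfl h
  | some a => simp

/-- The head moves left and rewrites the cells it passes. -/
theorem exec_left (f : Option (Cell A B Q) → Option (Cell A B Q))
    {u l r : List (Option (Cell A B Q))} {c d : Option (Cell A B Q)}
    (ho : ∀ e ∈ c :: u, micro o e = (some o, f e, .left))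
    (hf : ∀ e ∈ c :: u, f e ≠ none) (hd : d ≠ none) (hu : ∀ e ∈ u, e ≠ none)
    (hs : l.length + u.length + 1 < s)
    (h : Exec micro s (some o) ⟨l, d :: (((c :: u).map f).reverse ++ r)⟩ z) :
    Exec micro s (some o) ⟨u ++ d :: l, c :: r⟩ z := by
  induction u generalizing c r with
  | nil =>
    refine .step (by simpa using hs) ?_
    simpa [Zip.read, Zip.act, ho c, optCons_of_ne (hf c (by simp)), optCons_of_ne hd] using h
  | cons b u ih =>
    simp at hs
    refine .step (by simp; omega) ?_
    have := ih (c := b) (r := f c :: r) (fun e he => ho e (by simp at he; simp [he]))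
      (fun e he => hf e (by simp at he; simp [he])) (fun e he => hu e (by simp [he])) (by omega)
      (by simpa using h)
    simpa [Zip.read, Zip.act, ho c, optCons_of_ne (hf c (by simp)),
      optCons_of_ne (hu b (by simp))] using this

theorem exec_put (g : Option (Cell A B Q)) (m : Move) {z : Zip (Option (Cell A B Q))}
    (h : z.left.length + 1 < s) : Exec micro s (some (put g m)) z (z.act optCons g m) := by
  refine .step (by omega) (.done ?_)
  rw [Zip.left_length_act]
  cases m <;> simp [micro, Move.apply] <;> omega

theorem exec_move (m : Move) {z : Zip (Option (Cell A B Q))}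
    (h : z.left.length + 1 < s) :
    Exec micro s (some (move m)) z (z.act optCons (z.read none) m) := by
  refine .step (by omega) (.done ?_)
  rw [Zip.left_length_act]
  cases m <;> simp [micro, Move.apply] <;> omega

/-- The first blank marks the end of the stack, since no stored cell is blank. -/
theorem exec_seek {l r : List (Option (Cell A B Q))} (hr : ∀ c ∈ r, c ≠ none)
    (hs : l.length + r.length + 1 < s) :
    Exec micro s (some seek) ⟨l, r⟩ ⟨some .delim :: (r.reverse ++ l), []⟩ := by
  rw [← List.append_nil r]
  refine exec_right id (fun c hc => ?_) ?_
  · cases c with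
    | none => exact absurd rfl (hr _ hc)
    | some c => rfl
  · have : Exec (micro (A := A) (B := B) (Q := Q)) s none
        ⟨some .delim :: (r.reverse ++ l), []⟩ ⟨some .delim :: (r.reverse ++ l), []⟩ :=
      .done (by simp; omega)
    exact .step (by simp; omega) (by simpa [Zip.read, Zip.act, micro] using this)

theorem exec_mark {l : List (Option (Cell A B Q))} {r : List A}
    (hs : l.length + r.length + 2 < s) :
    Exec micro s (some mark) ⟨l, syms r⟩ ⟨some .delim :: pushed l r, []⟩ := by
  cases r with
  | nil =>
    refine .step (by simp; omega) ?_
    exact exec_seek (r := []) (by simp) (by simpa using hs)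
  | cons a r =>
    simp at hs
    refine .step (by simp; omega) ?_
    exact exec_seek (r := syms r) (fun c hc => (solid_syms r c hc).1) (by simp; omega)

/-- The last segment is removed. -/
theorem exec_erase (b : Bool) {u v l : List (Option (Cell A B Q))} {c : Option (Cell A B Q)}
    (hu : Solid u) (hv : Solid v) (hc : c ≠ none)
    (hs : l.length + u.length + v.length + 2 < s)
    (h : Exec micro s (if b then some unmark else some home) ⟨l, [c]⟩ z) :
    Exec micro s (some (erase b)) ⟨u ++ some .delim :: c :: l, v⟩ z := by
  rw [← List.append_nil v]
  refine exec_right id (fun c hc => ?_) ?_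
  · cases c with
    | none => exact absurd rfl (hv _ hc).1
    | some c => rfl
  refine .step (by simp; omega) ?_
  rw [List.map_id, ← List.append_assoc]
  have hw : Solid (v.reverse ++ u) := by
    intro c hc
    rw [List.mem_append, List.mem_reverse] at hc
    exact hc.elim (hv c) (hu c)
  have hs' : l.length + (v.reverse ++ u).length + 2 < s := by simp; omega
  generalize v.reverse ++ u = w at hw hs'
  have fin : Exec micro s (some (clear b)) ⟨c :: l, [some .delim]⟩ z := by
    refine .step (by simp; omega) ?_
    simpa [Zip.read, Zip.act, micro, optCons_of_ne hc] using h
  -- While the segment is cleared from the right, the right part is always a single cell, because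
  -- `optCons` drops the blanks behind it.
  have main : ∀ (w : List (Option (Cell A B Q))) (d : Option (Cell A B Q)), Solid (d :: w) →
      l.length + w.length + 2 < s →
      Exec micro s (some (clear b)) ⟨w ++ some .delim :: c :: l, [d]⟩ z := by
    intro w
    induction w with
    | nil =>
      intro d hd hs
      refine .step (by simpa using hs) ?_
      have hd' := hd d (by simp)
      have : micro (clear b) d = (some (clear b), none, .left) := by
        rcases d with _ | _ | _ <;> simp_all [micro]
      simpa [Zip.read, Zip.act, this] using fin
    | cons e w ih =>
      intro d hd hs
      simp at hs
      refine .step (by simp; omega) ?_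
      have hd' := hd d (by simp)
      have he' := hd e (by simp)
      have : micro (clear b) d = (some (clear b), none, .left) := by
        rcases d with _ | _ | _ <;> simp_all [micro]
      simpa [Zip.read, Zip.act, this, optCons_of_ne he'.1] using
        ih e (fun c hc => hd c (by simp at hc ⊢; tauto)) (by omega)
  cases w with
  | nil => simpa [Zip.read, Zip.act, micro] using fin
  | cons d w =>
    simp at hs'
    simpa [Zip.read, Zip.act, micro, optCons_of_ne (hw d (by simp)).1] using
      main w d hw (by omega)

/-- This undoes `exec_mark` up to equality of lists: the mark `marked none` of an unvisited head
cell turns into a blank, which `optCons` drops again. -/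
theorem exec_unmark {l : List (Option (Cell A B Q))} {r : List A}
    {u v : List (Option (Cell A B Q))} (hu : Solid u) (hv : Solid v)
    (hs : l.length + r.length + u.length + v.length + 2 < s) :
    Exec micro s (some (erase true)) ⟨u ++ some .delim :: pushed l r, v⟩ ⟨l, syms r⟩ := by
  have last : ∀ (a : Option A) (w : List (Option (Cell A B Q))),
      Exec micro s (some unmark) ⟨l, some (.marked a) :: w⟩
        ⟨l, optCons (a.map .sym) w⟩ := by
    intro a w
    refine .step (by simp; omega) (.done ?_)
    simp [Zip.read, Zip.act, micro]
    omega
  cases r with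
  | nil =>
    simp at hs
    exact exec_erase _ hu hv (by simp) (by omega) (last none [])
  | cons a r =>
    simp at hs
    rcases List.eq_nil_or_concat r with rfl | ⟨r, b, rfl⟩
    · exact exec_erase _ hu hv (by simp) (by simp at hs; omega) (last (some a) [])
    · simp at hs
      have h := last (some a) (syms (r ++ [b]))
      have : (pushed l (a :: (r ++ [b]))) =
          some (.sym b) :: ((syms r).reverse ++ some (.marked (some a)) :: l) := by
        simp [pushed, syms]
      simp only [List.concat_eq_append, this]
      refine exec_erase _ hu hv (by simp) (by simp; omega) ?_
      refine exec_left id ?_ ?_ (by simp) ?_ (by simp; omega) ?_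
      · intro e he
        have he' : e ∈ syms (b :: r.reverse) := by simpa [syms] using he
        simp only [syms, List.mem_map] at he'
        obtain ⟨x, -, rfl⟩ := he'
        rfl
      · intro e he
        have he' : e ∈ syms (b :: r.reverse) := by simpa [syms] using he
        exact (solid_syms _ e he').1
      · exact fun e he => ((solid_syms r).reverse e he).1
      · simpa [syms] using h

theorem exec_home {u l r : List (Option (Cell A B Q))} (hu : Solid u) (hr : Solid r)
    (hs : l.length + u.length + 1 < s) :
    Exec micro s (some home) ⟨u ++ some .delim :: l, r⟩ ⟨some .delim :: l, u.reverse ++ r⟩ := by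
  have last : ∀ w, Exec micro s (some home) ⟨l, some .delim :: w⟩ ⟨some .delim :: l, w⟩ := by
    intro w
    refine .step (by simp; omega) (.done ?_)
    simp [Zip.read, Zip.act, micro]
    omega
  have step : ∀ c : Option (Cell A B Q), c ≠ some .delim →
      micro home c = (some home, c, .left) := by
    rintro (_ | _ | _) hc <;> simp_all [micro]
  cases r with
  | cons c r =>
    refine exec_left id (fun e he => step e ?_) ?_ (by simp) (fun e he => (hu e he).1) hs ?_
    · exact (List.mem_cons.mp he).elim (fun h => h ▸ (hr c (by simp)).2) (fun h => (hu e h).2)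
    · exact fun e he => (List.mem_cons.mp he).elim (fun h => h ▸ (hr c (by simp)).1)
        (fun h => (hu e h).1)
    · simpa using last _
  | nil =>
    cases u with
    | nil =>
      refine .step (by simp at hs; simp; omega) ?_
      simpa [Zip.read, Zip.act, micro] using last _
    | cons c u =>
      simp at hs
      refine .step (by simp; omega) ?_
      have : Exec micro s (some home) ⟨u ++ some .delim :: l, [c]⟩
          ⟨some .delim :: l, u.reverse ++ [c]⟩ := by
        refine exec_left id (fun e he => step e (hu e he).2) (fun e he => (hu e he).1) (by simp)
          (fun e he => (hu e (by simp [he])).1) (by omega) ?_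
        simpa using last _
      simpa [Zip.read, Zip.act, micro, optCons_of_ne (hu c (by simp)).1] using this

/-- A counter is removed, and the head goes to the beginning of the counter below. -/
theorem exec_pop {u v w l : List (Option (Cell A B Q))} (hu : Solid u) (hv : Solid v)
    (hw : Solid w) (hs : l.length + u.length + v.length + w.length + 2 < s) :
    Exec micro s (some (erase false))
      ⟨u ++ some .delim :: (w.reverse ++ some .delim :: l), v⟩ ⟨some .delim :: l, w⟩ := by
  rcases List.eq_nil_or_concat w with rfl | ⟨w, c, rfl⟩
  · refine exec_erase _ hu hv (by simp) (by simpa using hs) ?_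
    refine .step (by simp at hs; simp; omega) (.done ?_)
    simp at hs
    simp [Zip.read, Zip.act, micro]
    omega
  · simp at hs
    have := hw c (by simp)
    simp only [List.concat_eq_append, List.reverse_append, List.reverse_cons, List.reverse_nil,
      List.nil_append, List.cons_append]
    refine exec_erase _ hu hv this.1 (by simp; omega) ?_
    have := exec_home (s := s) (u := w.reverse) (l := l) (r := [c])
      (fun e he => hw e (by simp at he; simp [he])) (fun e he => hw e (by simp at he; simp [he]))
      (by simp; omega)
    simpa using this

/-- The number that is given by a list of bits, the least significant one first. -/
def val : List Bool → ℕ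
  | [] => 0
  | b :: l => b.toNat + 2 * val l

theorem val_replicate_append (i : ℕ) (l : List Bool) :
    val (List.replicate i false ++ l) = 2 ^ i * val l := by
  induction i with
  | zero => simp
  | succ i ih => simp [List.replicate_succ, val, ih, pow_succ]; ring

theorem val_replicate_true_append (i : ℕ) (l : List Bool) :
    val (List.replicate i true ++ l) + 1 = 2 ^ i * (val l + 1) := by
  induction i with
  | zero => simp
  | succ i ih => simp [List.replicate_succ, val, pow_succ]; linarith

theorem val_bits (n : ℕ) : val n.bits = n := by
  induction n using Nat.binaryRec' with
  | zero => simp [val]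
  | bit b n h ih =>
    rw [Nat.bits_append_bit _ _ h, val, ih, Nat.bit_val]
    cases b <;> simp [add_comm]

/-- This locates the end of a carry (`b = true`) or of a borrow (`b = false`). -/
theorem eq_replicate_or (b : Bool) (l : List Bool) :
    (∃ i, l = List.replicate i b) ∨ ∃ i r, l = List.replicate i b ++ (!b) :: r := by
  induction l with
  | nil => exact .inl ⟨0, rfl⟩
  | cons a l ih =>
    by_cases h : a = b
    · rcases ih with ⟨i, rfl⟩ | ⟨i, r, rfl⟩
      · exact .inl ⟨i + 1, by simp [List.replicate_succ, h]⟩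
      · exact .inr ⟨i + 1, r, by simp [List.replicate_succ, h]⟩
    · exact .inr ⟨0, l, by cases a <;> cases b <;> simp_all⟩

/-- A counter grows only if all its `i` bits are one. Its new value is then `2 ^ i`, so it never
outgrows `k` bits while its value is below `2 ^ k`. -/
theorem exec_inc {l : List (Option (Cell A B Q))} {b : List Bool}
    (hs : l.length + b.length + 1 < s) :
    ∃ b', Exec micro s (some inc) ⟨some .delim :: l, bits b⟩ ⟨some .delim :: l, bits b'⟩ ∧
      val b' = val b + 1 ∧ ∀ k, b.length ≤ k → val b' < 2 ^ k → b'.length ≤ k := by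
  have loop : ∀ i (r z), Exec micro s (some inc)
      ⟨bits (List.replicate i false) ++ some .delim :: l, r⟩ z →
      Exec micro s (some inc)
        ⟨some .delim :: l, bits (List.replicate i true) ++ r⟩ z := by
    intro i r z h
    refine exec_right (fun _ => some (.bit false)) (fun c hc => ?_) ?_
    · obtain rfl : c = some (.bit true) := by
        simp [bits] at hc; exact hc.2
      rfl
    · simpa [bits] using h
  have back : ∀ i r, l.length + i + 1 < s → Exec micro s (some home)
      ⟨bits (List.replicate i false) ++ some .delim :: l, bits r⟩
      ⟨some .delim :: l, bits (List.replicate i false ++ r)⟩ := by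
    intro i r hi
    have := exec_home (s := s) (u := bits (List.replicate i false)) (l := l) (r := bits r)
      (solid_bits _) (solid_bits _) (by simpa using hi)
    simpa [bits] using this
  rcases eq_replicate_or true b with ⟨i, rfl⟩ | ⟨i, r, rfl⟩
  · simp at hs
    refine ⟨List.replicate i false ++ [true], ?_, ?_, ?_⟩
    · rw [← List.append_nil (bits (List.replicate i true))]
      refine loop _ _ _ (.step (by simp; omega) ?_)
      exact back i [true] hs
    · have := val_replicate_true_append i []
      rw [List.append_nil] at this
      rw [this, val_replicate_append]
      simp [val]
    · intro k hk h
      rw [val_replicate_append] at h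
      have := (Nat.pow_lt_pow_iff_right (by norm_num : 1 < 2)).mp
        (lt_of_le_of_lt (by simp [val]) h : 2 ^ i < 2 ^ k)
      simpa using this
  · simp at hs
    refine ⟨List.replicate i false ++ true :: r, ?_, ?_, ?_⟩
    · rw [bits_append]
      refine loop _ _ _ (.step (by simp; omega) ?_)
      exact back i (true :: r) (by omega)
    · rw [val_replicate_true_append, val_replicate_append]
      simp [val]; ring
    · intro k hk _
      simpa using hk

/-- The head of the tape is in its last segment, which is above `l` and has at most `k` cells. -/
def InSegment (l : List (Option (Cell A B Q))) (k : ℕ) (z : Zip (Option (Cell A B Q))) : Prop :=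
  ∃ u v, z = ⟨u ++ some .delim :: l, v⟩ ∧ Solid u ∧ Solid v ∧ u.length + v.length ≤ k

theorem InSegment.left_lt {l : List (Option (Cell A B Q))} {k : ℕ}
    {z : Zip (Option (Cell A B Q))} (h : InSegment l k z) (hs : l.length + k + 1 < s) :
    z.left.length < s := by
  obtain ⟨u, v, rfl, -, -, h⟩ := h
  simp
  omega

theorem inSegment_bits {l : List (Option (Cell A B Q))} {k : ℕ} {b : List Bool}
    (h : b.length ≤ k) : InSegment l k ⟨some .delim :: l, bits b⟩ :=
  ⟨[], bits b, rfl, by simp [Solid], solid_bits _, by simpa using h⟩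

theorem inSegment_bits' {l : List (Option (Cell A B Q))} {k : ℕ} {b : List Bool}
    (h : b.length ≤ k) : InSegment l k ⟨bits b ++ some .delim :: l, []⟩ :=
  ⟨bits b, [], rfl, solid_bits _, by simp [Solid], by simpa using h⟩

theorem InSegment.mono {l : List (Option (Cell A B Q))} {k k' : ℕ}
    {z : Zip (Option (Cell A B Q))} (h : InSegment l k z) (hk : k ≤ k') : InSegment l k' z := by
  obtain ⟨u, v, hz, hu, hv, h⟩ := h
  exact ⟨u, v, hz, hu, hv, h.trans hk⟩

/-- The tape after the operation `find` on a nonzero counter, whose value minus one is the number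
with the bits `b'`. -/
structure Found (s : ℕ) (l : List (Option (Cell A B Q))) (b b' : List Bool)
    (z : Zip (Option (Cell A B Q))) : Prop where
  find : Exec micro s (some find) ⟨some .delim :: l, bits b⟩ z
  read : z.read none = some (.bit true)
  dec : Exec micro s (some dec) z ⟨some .delim :: l, bits b'⟩
  dec' : Exec micro s (some Op.dec) ⟨some .delim :: l, bits b⟩ ⟨some .delim :: l, bits b'⟩
  length : b'.length = b.length
  val : val b' + 1 = val b

/-- The counter consists of `i` zeros, a one and a rest. Decrementing clears this one and sets the
zeros below it, whether it starts at the one or at the beginning of the counter. -/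
theorem exec_find_of_pos {l : List (Option (Cell A B Q))} {b : List Bool}
    (hs : l.length + b.length + 1 < s) (hb : val b ≠ 0) : ∃ b' z, Found s l b b' z := by
  rcases eq_replicate_or false b with ⟨i, rfl⟩ | ⟨i, r, rfl⟩
  · exact absurd (by simpa [val] using val_replicate_append i []) hb
  simp at hs
  have hdec : Exec micro s (some dec)
      ⟨bits (List.replicate i false) ++ some .delim :: l, bits (true :: r)⟩
      ⟨some .delim :: l, bits (List.replicate i true ++ false :: r)⟩ := by
    refine .step (by simp; omega) ?_
    have last : ∀ w, Exec micro s (some borrow) ⟨l, some .delim :: w⟩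
        ⟨some .delim :: l, w⟩ := by
      intro w
      refine .step (by simp; omega) (.done ?_)
      simp [Zip.read, Zip.act, micro]
      omega
    cases i with
    | zero => simpa [Zip.read, Zip.act, micro] using last _
    | succ i =>
      have : Exec micro s (some borrow)
          ⟨bits (List.replicate i false) ++ some .delim :: l,
            some (.bit false) :: some (.bit false) :: bits r⟩
          ⟨some .delim :: l, bits (List.replicate (i + 1) true ++ false :: r)⟩ := by
        have hm : ∀ e ∈ (some (.bit false) :: bits (List.replicate i false) :
            List (Option (Cell A B Q))), e = some (.bit false) := by
          simp [bits]
        refine exec_left (fun _ => some (.bit true)) (fun e he => ?_) (by simp) (by simp)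
          (fun e he => (solid_bits _ e he).1) (by simp; omega) ?_
        · rw [hm e he]; rfl
        · simpa [bits, List.replicate_succ', List.replicate_succ] using last _
      simpa [Zip.read, Zip.act, micro, List.replicate_succ] using this
  refine ⟨_, ⟨bits (List.replicate i false) ++ some .delim :: l, bits (true :: r)⟩, ?_, rfl, hdec,
    ?_, by simp, ?_⟩
  · rw [bits_append]
    refine exec_right id (fun c hc => ?_) (.step ?_ ?_)
    · obtain rfl : c = some (.bit false) := by simp [bits] at hc; exact hc.2
      rfl
    · simp; omega
    · have : Exec (micro (A := A) (B := B) (Q := Q)) s none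
          ⟨bits (List.replicate i false) ++ some .delim :: l, bits (true :: r)⟩
          ⟨bits (List.replicate i false) ++ some .delim :: l, bits (true :: r)⟩ :=
        .done (by simp; omega)
      simpa [Zip.read, Zip.act, micro, bits] using this
  · rw [bits_append (List.replicate i false)]
    refine exec_right id (fun c hc => ?_) (by simpa [bits] using hdec)
    obtain rfl : c = some (.bit false) := by simp [bits] at hc; exact hc.2
    rfl
  · rw [val_replicate_true_append, val_replicate_append]
    simp [val]; ring

/-- The head runs off the counter; reading a blank there is the test for zero. -/
theorem exec_find_of_zero {l : List (Option (Cell A B Q))} {b : List Bool}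
    (hs : l.length + b.length + 1 < s) (hb : val b = 0) :
    Exec micro s (some find) ⟨some .delim :: l, bits b⟩ ⟨bits b ++ some .delim :: l, []⟩ := by
  rcases eq_replicate_or false b with ⟨i, rfl⟩ | ⟨i, r, rfl⟩
  · simp at hs
    rw [← List.append_nil (bits _)]
    refine exec_right id (fun c hc => ?_) (.step ?_ ?_)
    · obtain rfl : c = some (.bit false) := by simp [bits] at hc; exact hc.2
      rfl
    · simp; omega
    · have : Exec (micro (A := A) (B := B) (Q := Q)) s none
          ⟨bits (List.replicate i false) ++ some .delim :: l, []⟩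
          ⟨bits (List.replicate i false) ++ some .delim :: l, []⟩ := .done (by simp; omega)
      simpa [Zip.read, Zip.act, micro, bits] using this
  · rw [val_replicate_append] at hb
    simp [val] at hb

end Op

/-! ### The program that iterates a transducer. -/

namespace Iteration

/-- The control states of the program that iterates a transducer. Here `Q₁` and `Q₂` are the states
of the transducer that computes the number of iterations and of the iterated transducer. -/
inductive Ctl (α Q₁ Q₂ : Type) where
  | start : Ctl α Q₁ Q₂
  | count : Q₁ → Ctl α Q₁ Q₂
  | unary : Ctl α Q₁ Q₂
  | unaryTest : Ctl α Q₁ Q₂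
  | call : Ctl α Q₁ Q₂
  | copy : Ctl α Q₁ Q₂
  | enter : Ctl α Q₁ Q₂
  | enterTest : Ctl α Q₁ Q₂
  | rewind : Ctl α Q₁ Q₂
  | scan : Ctl α Q₁ Q₂
  | scanTest : Ctl α Q₁ Q₂
  | run : Q₂ → Ctl α Q₁ Q₂
  | emitTest : Q₂ → α → Ctl α Q₁ Q₂
  | ret : InputSymbol α → Ctl α Q₁ Q₂
  | resume : InputSymbol α → Ctl α Q₁ Q₂

instance (α : Type) [Finite α] : Finite (InputSymbol α) := by
  rw [← Set.finite_univ_iff]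
  refine (Set.toFinite (Set.range InputSymbol.letter ∪ {.leftEnd, .rightEnd})).subset ?_
  rintro (_ | _ | _) - <;> simp

instance (α Q₁ Q₂ : Type) [Finite α] [Finite Q₁] [Finite Q₂] : Finite (Ctl α Q₁ Q₂) := by
  rw [← Set.finite_univ_iff]
  refine (Set.toFinite (Set.range Ctl.count ∪ Set.range Ctl.run ∪ Set.range Ctl.ret ∪
    Set.range Ctl.resume ∪ Set.range (fun a : Q₂ × α => Ctl.emitTest a.1 a.2) ∪
    {.start, .unary, .unaryTest, .call, .copy, .enter, .enterTest, .rewind, .scan,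
      .scanTest})).subset ?_
  rintro (_ | _ | _ | _ | _ | _ | _ | _ | _ | _ | _ | _ | _ | _ | _) - <;> simp

/-- The work tapes: those of the transducer that computes the number of iterations, those of the
iterated transducer, and
* `callers`: the states of the suspended simulations, and the number of levels that are left;
* `pos`: the positions of the input heads of the simulations;
* `rem`: for every simulation, the number of letters that have to be skipped in its output. -/
inductive TapeId (T₁ T₂ : Type) where
  | aux : T₁ → TapeId T₁ T₂
  | main : T₂ → TapeId T₁ T₂
  | callers : TapeId T₁ T₂
  | pos : TapeId T₁ T₂
  | rem : TapeId T₁ T₂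

instance (T₁ T₂ : Type) [Finite T₁] [Finite T₂] : Finite (TapeId T₁ T₂) := by
  rw [← Set.finite_univ_iff]
  refine (Set.toFinite (Set.range TapeId.aux ∪ Set.range TapeId.main ∪
    {.callers, .pos, .rem})).subset ?_
  rintro (_ | _ | _ | _ | _) - <;> simp

/-- A function on the tapes. -/
def onTapes {T₁ T₂ C : Type} (n : T₁ → C) (m : T₂ → C) (c p r : C) : TapeId T₁ T₂ → C
  | .aux t => n t
  | .main t => m t
  | .callers => c
  | .pos => p
  | .rem => r

/-- The operation on the tape `pos` that corresponds to a movement of the input head. -/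
def shift {α Γ : Type} : InputSymbol α → Move → Option (Op Γ)
  | .leftEnd, .left => none
  | _, .left => some .dec
  | _, .stay => none
  | .rightEnd, .right => none
  | _, .right => some .inc

/-- The symbol of the iterated transducer in a cell. -/
def decode {A B Q : Type} (b : A) : Option (Cell A B Q) → A
  | some (.sym a) => a
  | _ => b

/-- The symbol of the transducer for the number of iterations in a cell. -/
def decodeAux {A B Q : Type} (b : B) : Option (Cell A B Q) → B
  | some (.aux a) => a
  | _ => b

variable {α : Type} (M : Transducer α α) (N : Transducer α Bool)

/-- The symbols on the work tapes. -/
abbrev Sym : Type := Cell M.Symbol N.Symbol M.State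

/-- The commands of the program. -/
def next : Ctl α N.State M.State → InputSymbol α → (TapeId N.Tape M.Tape → Option (Sym M N)) →
    Option (Command (Ctl α N.State M.State) (TapeId N.Tape M.Tape) (Op (Sym M N)) α)
  | .start, _, _ =>
    some ⟨.count N.start, .stay, onTapes (fun _ => none) (fun _ => none)
      (some (.put (some .delim) .right)) (some (.put (some .delim) .right))
      (some (.put (some .delim) .right)), none⟩
  | .count q, i, g =>
    match N.next q i (fun t => decodeAux N.blank (g (.aux t))) with
    | none => some ⟨.unary, .stay, onTapes (fun _ => none) (fun _ => none) none none
        (some .home), none⟩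
    | some a => some ⟨.count a.state, a.moveInput,
        onTapes (fun t => some (.put (some (.aux (a.write t))) (a.moveWork t))) (fun _ => none)
          none none (a.emit.map fun b => .put (some (.bit b)) .right), none⟩
  | .unary, _, _ =>
    some ⟨.unaryTest, .stay, onTapes (fun _ => none) (fun _ => none) none none (some .find), none⟩
  | .unaryTest, _, g =>
    match g .rem with
    | some (.bit true) => some ⟨.unary, .stay, onTapes (fun _ => none) (fun _ => none)
        (some (.put (some .level) .right)) none (some .dec), none⟩
    | _ => some ⟨.call, .stay, onTapes (fun _ => none) (fun _ => none) (some .home) none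
        (some .home), none⟩
  | .call, _, _ =>
    some ⟨.copy, .stay, onTapes (fun _ => none) (fun _ => some .mark) none none
      (some .seek), none⟩
  | .copy, _, g =>
    match g .pos with
    | some c => some ⟨.copy, .stay, onTapes (fun _ => none) (fun _ => none) none
        (some (.put (some c) .right)) (some (.put (some c) .right)), none⟩
    | none => some ⟨.enter, .stay, onTapes (fun _ => none) (fun _ => none) none
        (some (.put (some .delim) .right)) (some .home), none⟩
  | .enter, _, _ =>
    some ⟨.enterTest, .stay, onTapes (fun _ => none) (fun _ => none) none none (some .find), none⟩
  | .enterTest, _, g =>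
    match g .rem, g .callers with
    -- A cell under the head of `callers` means that a level is left; a blank means that a letter of
    -- the real input is wanted.
    | some (.bit true), some _ => some ⟨.run M.start, .stay,
        onTapes (fun _ => none) (fun _ => none) none none (some .dec), none⟩
    | some (.bit true), none => some ⟨.rewind, .stay,
        onTapes (fun _ => none) (fun _ => none) none none (some .dec), none⟩
    | _, _ => some ⟨.ret .leftEnd, .stay,
        onTapes (fun _ => none) (fun _ => none) none none none, none⟩
  | .rewind, .leftEnd, _ =>
    some ⟨.scan, .right, onTapes (fun _ => none) (fun _ => none) none none none, none⟩
  | .rewind, _, _ =>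
    some ⟨.rewind, .left, onTapes (fun _ => none) (fun _ => none) none none none, none⟩
  | .scan, _, _ =>
    some ⟨.scanTest, .stay, onTapes (fun _ => none) (fun _ => none) none none (some .find), none⟩
  | .scanTest, i, g =>
    match g .rem with
    | some (.bit true) => some ⟨.scan, .right, onTapes (fun _ => none) (fun _ => none) none none
        (some .dec), none⟩
    | _ => some ⟨.ret i, .stay, onTapes (fun _ => none) (fun _ => none) none none none, none⟩
  | .run q, _, _ =>
    some ⟨.call, .stay, onTapes (fun _ => none) (fun _ => none)
      (some (.put (some (.caller q)) .right)) none none, none⟩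
  | .emitTest q b, _, g =>
    match g .rem with
    | some (.bit true) => some ⟨.run q, .stay, onTapes (fun _ => none) (fun _ => none) none none
        (some .dec), none⟩
    | _ => some ⟨.ret (.letter b), .stay,
        onTapes (fun _ => none) (fun _ => none) none none none, none⟩
  | .ret i, _, _ =>
    some ⟨.resume i, .stay, onTapes (fun _ => none) (fun _ => some (.erase true))
      (some (.move .left)) (some (.erase false)) (some (.erase false)), none⟩
  | .resume i, _, g =>
    match g .callers with
    | some (.caller q) =>
      match M.next q i (fun t => decode M.blank (g (.main t))) with
      | none => some ⟨.ret .rightEnd, .stay, onTapes (fun _ => none) (fun _ => none)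
          (some (.put (some .level) .stay)) none none, none⟩
      | some a =>
        match a.emit with
        | none => some ⟨.run a.state, .stay, onTapes (fun _ => none)
            (fun t => some (.write (some (.sym (a.write t))) (a.moveWork t)))
            (some (.put (some .level) .stay)) (shift i a.moveInput) none, none⟩
        | some b => some ⟨.emitTest a.state b, .stay, onTapes (fun _ => none)
            (fun t => some (.write (some (.sym (a.write t))) (a.moveWork t)))
            (some (.put (some .level) .stay)) (shift i a.moveInput) (some .find), none⟩
    -- No suspended run is waiting: the symbol answers a request of the main loop, which prints it
    -- and asks for the next position.
    | _ =>
      match i with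
      | .leftEnd => some ⟨.call, .stay, onTapes (fun _ => none) (fun _ => none)
          (some (.move .right)) (some .inc) none, none⟩
      | .letter a => some ⟨.call, .stay, onTapes (fun _ => none) (fun _ => none)
          (some (.move .right)) (some .inc) none, some a⟩
      | .rightEnd => none

/-- The program that applies `M` to the input as often as the output of `N` says. -/
def program [Finite α] : Program α α where
  State := Ctl α N.State M.State
  Tape := TapeId N.Tape M.Tape
  Symbol := Sym M N
  Op := Op (Sym M N)
  finiteState := by have := M.finiteState; have := N.finiteState; infer_instance
  finiteTape := by have := M.finiteTape; have := N.finiteTape; infer_instance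
  finiteSymbol := by
    have := M.finiteSymbol; have := N.finiteSymbol; have := M.finiteState; infer_instance
  finiteOp := by
    have := M.finiteSymbol; have := N.finiteSymbol; have := M.finiteState; infer_instance
  start := .start
  next := next M N
  micro := Op.micro

open Op Transducer

variable {M N}

/-- The type of tapes of the program. -/
abbrev Tp (M : Transducer α α) (N : Transducer α Bool) : Type := Zip (Option (Sym M N))

variable {x : List α} {s : ℕ}

/-- The marks for `k` levels. -/
abbrev levels (k : ℕ) : List (Option (Sym M N)) := List.replicate k (some .level)

/-- The tape `z` of the iterated transducer, in a segment above `l`. -/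
def frame (l : List (Option (Sym M N))) (z : Zip M.Symbol) : Tp M N :=
  ⟨syms z.left ++ some .delim :: l, syms z.right⟩

/-- Moving left from cell `0` of the simulated tape lands on the delimiter of the segment; `bounce`
then steps back, as the convention for `Move.apply` requires. -/
theorem exec_write {l : List (Option (Sym M N))} {z : Zip M.Symbol} (a : M.Symbol) (v : Move)
    (hs : l.length + z.left.length + 2 < s) :
    Exec micro s (some (.write (some (.sym a)) v)) (frame l z)
      (frame l (z.act List.cons a v) : Tp M N) := by
  obtain ⟨u, r⟩ := z
  simp at hs
  have ht : (syms r : List (Option (Sym M N))).tail = syms r.tail := by cases r <;> rfl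
  refine .step (by simp [frame]; omega) ?_
  have hb : ∀ (r : List M.Symbol),
      micro bounce (Zip.read none (frame l ⟨u, r⟩)) =
        (none, Zip.read none (frame l ⟨u, r⟩ : Tp M N), .stay) := by
    intro r; cases r <;> rfl
  cases v with
  | stay =>
    refine .step (by simp [frame, Zip.act, micro]; omega) ?_
    have : Exec micro s none (frame l ⟨u, a :: r.tail⟩) (frame l ⟨u, a :: r.tail⟩ : Tp M N) :=
      .done (by simp [frame]; omega)
    simpa [frame, Zip.act, micro, Zip.read, syms, ht] using this
  | right =>
    refine .step (by simp [frame, Zip.act, micro]; omega) ?_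
    have : Exec micro s none (frame l ⟨a :: u, r.tail⟩) (frame l ⟨a :: u, r.tail⟩ : Tp M N) :=
      .done (by simp [frame]; omega)
    cases r with
    | nil => simpa [frame, Zip.act, micro, Zip.read, syms, ht] using this
    | cons b r => cases r <;> simpa [frame, Zip.act, micro, Zip.read, syms, ht] using this
  | left =>
    cases u with
    | nil =>
      refine .step (by simp [frame, Zip.act, micro, syms]; omega) ?_
      have : Exec micro s none (frame l ⟨[], a :: r.tail⟩) (frame l ⟨[], a :: r.tail⟩ : Tp M N) :=
        .done (by simp [frame]; omega)
      simpa [frame, Zip.act, micro, Zip.read, syms, ht] using this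
    | cons b u =>
      simp at hs
      refine .step (by simp [frame, Zip.act, micro, syms]; omega) ?_
      have : Exec micro s none (frame l ⟨u, b :: a :: r.tail⟩)
          (frame l ⟨u, b :: a :: r.tail⟩ : Tp M N) := .done (by simp [frame]; omega)
      simpa [frame, Zip.act, micro, Zip.read, syms, ht] using this

theorem decode_frame (l : List (Option (Sym M N))) (z : Zip M.Symbol) :
    decode M.blank ((frame l z : Tp M N).read none) = z.read M.blank := by
  obtain ⟨u, r⟩ := z
  cases r <;> rfl

theorem inputAt_eq_leftEnd {y : List α} {i : ℕ} : inputAt y i = .leftEnd ↔ i = 0 := by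
  cases i with
  | zero => simp [inputAt]
  | succ i => simp only [inputAt]; split <;> simp

theorem inputAt_eq_rightEnd {y : List α} {i : ℕ} :
    inputAt y i = .rightEnd ↔ y.length + 1 ≤ i := by
  cases i with
  | zero => simp [inputAt]
  | succ i =>
    simp only [inputAt]
    split
    · rename_i h
      simpa using (List.getElem?_eq_some_iff.mp h).1
    · simp_all

theorem inputAt_min (y : List α) (i : ℕ) : inputAt y (min i (y.length + 1)) = inputAt y i := by
  rcases le_total i (y.length + 1) with h | h
  · rw [min_eq_left h]
  · rw [min_eq_right h, inputAt_eq_rightEnd.mpr le_rfl, inputAt_eq_rightEnd.mpr h]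

/-- The symbol just read shows whether the head is at an end of its input, so the cut-off at both
ends needs no comparison with the length of `y`, which the program does not know. -/
theorem exec_shift {y : List α} {l : List (Option (Sym M N))} {b : List Bool} {k : ℕ} (v : Move)
    (hb : val b ≤ y.length + 1) (hk : b.length ≤ k) (hy : y.length + 2 < 2 ^ k)
    (hs : l.length + b.length + 1 < s) :
    ∃ b', Exec micro s (shift (inputAt y (val b)) v) (⟨some .delim :: l, bits b⟩ : Tp M N)
        ⟨some .delim :: l, bits b'⟩ ∧
      val b' = min (v.apply (val b)) (y.length + 1) ∧ b'.length ≤ k := by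
  have idle : Exec micro s none (⟨some .delim :: l, bits b⟩ : Tp M N)
      ⟨some .delim :: l, bits b⟩ := .done (by simp; omega)
  cases v with
  | stay =>
    refine ⟨b, ?_, by simp [Move.apply, hb], hk⟩
    cases inputAt y (val b) <;> exact idle
  | left =>
    by_cases h : val b = 0
    · refine ⟨b, ?_, by simp [Move.apply, h], hk⟩
      rw [inputAt_eq_leftEnd.mpr h]
      exact idle
    · obtain ⟨b', z, hf⟩ := exec_find_of_pos hs h
      refine ⟨b', ?_, ?_, by rw [hf.length]; exact hk⟩
      · have := mt (inputAt_eq_leftEnd (y := y)).mp h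
        revert this
        cases inputAt y (val b) <;> intro h
        · exact absurd rfl h
        · exact hf.dec'
        · exact hf.dec'
      · have := hf.val
        simp only [Move.apply]; omega
  | right =>
    by_cases h : y.length + 1 ≤ val b
    · refine ⟨b, ?_, by simp only [Move.apply]; omega, hk⟩
      rw [inputAt_eq_rightEnd.mpr h]
      exact idle
    · obtain ⟨b', hf, hv, hl⟩ := exec_inc (A := M.Symbol) (B := N.Symbol) (Q := M.State) hs
      refine ⟨b', ?_, by simp only [Move.apply]; omega, hl k hk (by omega)⟩
      have := mt (inputAt_eq_rightEnd (y := y)).mp h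
      revert this
      cases inputAt y (val b) <;> intro h
      · exact hf
      · exact hf
      · exact absurd rfl h

variable [Finite α]

/-- A configuration of the program. -/
def mk (q : Ctl α N.State M.State) (i : ℕ) (n : N.Tape → Tp M N) (m : M.Tape → Tp M N)
    (c p r : Tp M N) (y : List α) : (program M N).Cfg where
  state := q
  inputPos := i
  tapes := onTapes n m c p r
  output := y

/-- The configuration `a` leads to the configuration `b`. -/
abbrev Leads (x : List α) (s : ℕ) (a b : (program M N).Cfg) : Prop := (program M N).Reach x s a b

theorem leads_single {q q' : Ctl α N.State M.State} {i : ℕ} {n n' : N.Tape → Tp M N}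
    {m m' : M.Tape → Tp M N} {c c' p p' r r' : Tp M N} {y : List α} {v : Move}
    {on : N.Tape → Option (Op (Sym M N))} {om : M.Tape → Option (Op (Sym M N))}
    {oc op or : Option (Op (Sym M N))} {e : Option α}
    (h : next M N q (inputAt x i) (fun t => (onTapes n m c p r t).read none) =
      some ⟨q', v, onTapes on om oc op or, e⟩)
    (hn : ∀ t, Exec micro s (on t) (n t) (n' t)) (hm : ∀ t, Exec micro s (om t) (m t) (m' t))
    (hc : Exec micro s oc c c') (hp : Exec micro s op p p') (hr : Exec micro s or r r') :
    Leads x s (mk q i n m c p r y)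
      (mk q' (min (v.apply i) (x.length + 1)) n' m' c' p' r' (y ++ e.toList)) := by
  refine .single ⟨_, h, rfl, rfl, rfl, ?_⟩
  rintro (t | t | _ | _ | _)
  exacts [hn t, hm t, hc, hp, hr]

end Iteration

end LogComp

/-! ### Correctness of the recursive calls. -/

namespace LogComp

namespace Iteration

open Op Transducer

variable {α : Type} [Finite α] {M : Transducer α α} {N : Transducer α Bool} {x : List α} {s : ℕ}

theorem Leads.trans {a b c : (program M N).Cfg} (h : Leads x s a b) (h' : Leads x s b c) :
    Leads x s a c := Relation.ReflTransGen.trans h h'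

theorem leads_silent {q q' : Ctl α N.State M.State} {i : ℕ} {n n' : N.Tape → Tp M N}
    {m m' : M.Tape → Tp M N} {c c' p p' r r' : Tp M N} {y : List α} {v : Move}
    {on : N.Tape → Option (Op (Sym M N))} {om : M.Tape → Option (Op (Sym M N))}
    {oc op or : Option (Op (Sym M N))}
    (h : next M N q (inputAt x i) (fun t => (onTapes n m c p r t).read none) =
      some ⟨q', v, onTapes on om oc op or, none⟩)
    (hn : ∀ t, Exec micro s (on t) (n t) (n' t)) (hm : ∀ t, Exec micro s (om t) (m t) (m' t))
    (hc : Exec micro s oc c c') (hp : Exec micro s op p p') (hr : Exec micro s or r r') :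
    Leads x s (mk q i n m c p r y)
      (mk q' (min (v.apply i) (x.length + 1)) n' m' c' p' r' y) := by
  simpa using leads_single (y := y) h hn hm hc hp hr

theorem leads_copy {n : N.Tape → Tp M N} {m : M.Tape → Tp M N} {c : Tp M N}
    {u v : List (Option (Sym M N))} {b : List Bool} {y : List α} (i : ℕ)
    (hn : ∀ t, (n t).left.length < s) (hm : ∀ t, (m t).left.length < s) (hc : c.left.length < s)
    (hu : u.length + b.length + 1 < s) (hv : v.length + b.length + 1 < s) :
    ∃ i', Leads x s (mk .copy i n m c ⟨u, bits b⟩ ⟨v, []⟩ y)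
      (mk .copy i' n m c ⟨(bits b).reverse ++ u, []⟩ ⟨(bits b).reverse ++ v, []⟩ y) := by
  induction b generalizing i u v with
  | nil => exact ⟨i, .refl⟩
  | cons a b ih =>
    simp at hu hv
    obtain ⟨i', h⟩ := ih (u := some (.bit a) :: u) (v := some (.bit a) :: v)
      (min (Move.stay.apply i) (x.length + 1)) (by simp; omega) (by simp; omega)
    refine ⟨i', (leads_silent rfl (fun t => .done (hn t)) (fun t => .done (hm t)) (.done hc)
      (exec_put _ _ ?_) (exec_put _ _ ?_)).trans ?_⟩
    · simp; omega
    · simp; omega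
    · simpa [Zip.act] using h

theorem leads_rewind {n : N.Tape → Tp M N} {m : M.Tape → Tp M N} {c p r : Tp M N}
    {y : List α} (i : ℕ)
    (hn : ∀ t, (n t).left.length < s) (hm : ∀ t, (m t).left.length < s) (hc : c.left.length < s)
    (hp : p.left.length < s) (hr : r.left.length < s) :
    Leads x s (mk .rewind i n m c p r y) (mk .scan 1 n m c p r y) := by
  induction i using Nat.strong_induction_on with
  | _ i ih =>
    cases i with
    | zero =>
      have := leads_silent (x := x) (i := 0) (q := .rewind) (y := y) rfl (fun t => .done (hn t))
        (fun t => .done (hm t)) (.done hc) (.done hp) (.done hr)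
      simpa [Move.apply] using this
    | succ i =>
      refine (leads_silent (v := .left) (on := fun _ => none) (om := fun _ => none) (oc := none)
        (op := none) (or := none) ?_ (fun t => .done (hn t))
        (fun t => .done (hm t)) (.done hc) (.done hp) (.done hr)).trans (ih _ ?_)
      · simp only [inputAt]
        split <;> rfl
      · simp [Move.apply]

theorem leads_scan {n : N.Tape → Tp M N} {m : M.Tape → Tp M N} {c p : Tp M N}
    {l : List (Option (Sym M N))} {y : List α} {v : ℕ}
    (hn : ∀ t, (n t).left.length < s) (hm : ∀ t, (m t).left.length < s) (hc : c.left.length < s)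
    (hp : p.left.length < s) {i : ℕ} {b : List Bool} (hi : i ≤ x.length + 1) (hv : val b = v)
    (hb : l.length + b.length + 1 < s) :
    ∃ i' r, Leads x s (mk .scan i n m c p ⟨some .delim :: l, bits b⟩ y)
      (mk (.ret (inputAt x (i + v))) i' n m c p r y) ∧ InSegment l b.length r := by
  induction v generalizing i b with
  | zero =>
    have hi' : min (Move.stay.apply i) (x.length + 1) = i := by simp [Move.apply, hi]
    refine ⟨i, _, ?_, inSegment_bits' le_rfl⟩
    have h1 := leads_silent (x := x) (i := i) (q := .scan) (y := y) rfl (fun t => .done (hn t))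
      (fun t => .done (hm t)) (.done hc) (.done hp) (exec_find_of_zero hb hv)
    have h2 := leads_silent (x := x) (i := i) (q := .scanTest) (y := y)
      (r := ⟨bits b ++ some .delim :: l, []⟩) rfl (fun t => .done (hn t))
      (fun t => .done (hm t)) (.done hc) (.done hp) (.done (by simp; omega))
    rw [hi'] at h1 h2
    exact h1.trans h2
  | succ v ih =>
    have hi' : min (Move.stay.apply i) (x.length + 1) = i := by simp [Move.apply, hi]
    obtain ⟨b', z, hf⟩ := exec_find_of_pos hb (by omega)
    have h1 := leads_silent (x := x) (i := i) (q := .scan) (y := y) rfl (fun t => .done (hn t))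
      (fun t => .done (hm t)) (.done hc) (.done hp) hf.find
    rw [hi'] at h1
    obtain ⟨i', r, h, hr⟩ := ih (i := min (Move.right.apply i) (x.length + 1))
      (b := b') (min_le_right _ _) (by have := hf.val; omega) (by rw [hf.length]; exact hb)
    have h2 : Leads x s (mk .scanTest i n m c p z y) _ :=
      leads_silent (q' := .scan) (v := .right) (on := fun _ => none) (om := fun _ => none)
        (oc := none) (op := none) (by simp only [next, onTapes, hf.read])
        (fun t => .done (hn t)) (fun t => .done (hm t)) (.done hc) (.done hp) hf.dec
    refine ⟨i', r, h1.trans (h2.trans ?_), hr.mono hf.length.le⟩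
    convert h using 3
    -- The head may have been stopped at the right end marker; from there on the visible symbol no
    -- longer depends on the position.
    rw [← inputAt_min x (i + (v + 1)), ← inputAt_min x (_ + v)]
    congr 1
    simp only [Move.apply]
    omega

/-- Returning pops the segments opened by the call and moves the head of `callers` onto the symbol
`c` of the caller. -/
theorem leads_ret {n : N.Tape → Tp M N} {l : M.Tape → List (Option (Sym M N))}
    {r : M.Tape → List M.Symbol} {m : M.Tape → Tp M N} {p' r' : Tp M N}
    {c : Option (Sym M N)} {lS lP lR : List (Option (Sym M N))}
    {bP bR : List Bool} {y : List α} {a : InputSymbol α} {B : ℕ} (k i : ℕ)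
    (hn : ∀ t, (n t).left.length < s) (hm : ∀ t, InSegment (pushed (l t) (r t)) B (m t))
    (hp : InSegment ((bits bP).reverse ++ some .delim :: lP) B p')
    (hr : InSegment ((bits bR).reverse ++ some .delim :: lR) B r') (hc : c ≠ none)
    (hl : ∀ t, (l t).length + (r t).length + B + 2 < s) (hS : lS.length + 2 < s)
    (hP : lP.length + bP.length + B + 2 < s) (hR : lR.length + bR.length + B + 2 < s) :
    ∃ i', Leads x s (mk (.ret a) i n m ⟨c :: lS, levels k⟩ p' r' y)
      (mk (.resume a) i' n (fun t => ⟨l t, syms (r t)⟩) ⟨lS, c :: levels k⟩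
        ⟨some .delim :: lP, bits bP⟩ ⟨some .delim :: lR, bits bR⟩ y) := by
  obtain ⟨up, vp, rfl, hup, hvp, hp⟩ := hp
  obtain ⟨ur, vr, rfl, hur, hvr, hr⟩ := hr
  refine ⟨_, leads_silent rfl (fun t => .done (hn t)) (fun t => ?_) ?_
    (exec_pop hup hvp (solid_bits _) (by simp; omega))
    (exec_pop hur hvr (solid_bits _) (by simp; omega))⟩
  · obtain ⟨u, v, hz, hu, hv, h⟩ := hm t
    rw [hz]
    exact exec_unmark hu hv (by have := hl t; omega)
  have := exec_move (s := s) .left (z := ⟨c :: lS, levels (M := M) (N := N) k⟩) (by simpa using hS)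
  cases k with
  | zero => simpa [Zip.act, Zip.read, optCons_of_ne hc] using this
  | succ k => simpa [Zip.act, Zip.read, optCons_of_ne hc, List.replicate_succ] using this

/-- The subroutine `call` finds a symbol of `Y k`, if there are `k` levels left. -/
def CallSpec (M : Transducer α α) (N : Transducer α Bool) (x : List α) (Y : ℕ → List α)
    (B s k : ℕ) : Prop :=
  ∀ (n : N.Tape → Tp M N) (l : M.Tape → List (Option (Sym M N))) (r : M.Tape → List M.Symbol)
    (c : Option (Sym M N)) (lS lP lR : List (Option (Sym M N))) (bP bR : List Bool) (y : List α)
    (i : ℕ), (∀ t, (n t).left.length < s) → c ≠ none → bP.length ≤ B →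
    (∀ t, (l t).length + (r t).length + (k + 1) * (B + 2) < s) →
    lS.length + k + 2 < s →
    lP.length + bP.length + 1 + (k + 1) * (B + 2) < s →
    lR.length + bR.length + 1 + (k + 1) * (B + 2) < s →
    ∃ i', Leads x s (mk .call i n (fun t => ⟨l t, syms (r t)⟩) ⟨c :: lS, levels k⟩
        ⟨some .delim :: lP, bits bP⟩ ⟨some .delim :: lR, bits bR⟩ y)
      (mk (.resume (inputAt (Y k) (val bP))) i' n (fun t => ⟨l t, syms (r t)⟩)
        ⟨lS, c :: levels k⟩ ⟨some .delim :: lP, bits bP⟩ ⟨some .delim :: lR, bits bR⟩ y)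

omit [Finite α] in
-- Output is never erased, so from any configuration on a run the output still to come is well
-- defined.
theorem output_prefix {β : Type} {M : Transducer α β} {c d : M.Cfg}
    (h : StateTransition.Reaches (M.step x) c d) : c.output <+: d.output := by
  induction h with
  | refl => exact List.prefix_rfl
  | tail _ h ih =>
    simp only [step, Option.mem_def, Option.map_eq_some_iff] at h
    obtain ⟨a, -, rfl⟩ := h
    exact ih.trans (List.prefix_append _ _)

@[simp] theorem read_cons {A : Type} (a : A) (l r : List (Option A)) :
    Zip.read none ⟨l, some a :: r⟩ = some a := rfl

/-- One input symbol of the simulated machine is obtained by a call one level down. The suspended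
state overwrites a level mark, so `callers` keeps its length while the number of levels left drops
by one. -/
theorem leads_fetch {Y : ℕ → List α} {B k : ℕ} (hcall : CallSpec M N x Y B s k)
    {n : N.Tape → Tp M N} (hn : ∀ t, (n t).left.length < s)
    {l : M.Tape → List (Option (Sym M N))} {c₀ : Option (Sym M N)}
    {lS lP lR : List (Option (Sym M N))} {y : List α}
    (hl : ∀ t, (l t).length + B + (k + 1) * (B + 2) + 1 < s)
    (hS : lS.length + k + 3 < s)
    (hP : lP.length + B + (k + 1) * (B + 2) + 1 < s)
    (hR : lR.length + B + (k + 1) * (B + 2) + 1 < s) {z : M.Tape → Zip M.Symbol}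
    (hzB : ∀ t, (z t).left.length + (z t).right.length ≤ B) {bP bR : List Bool}
    (hbPB : bP.length ≤ B) (hbRB : bR.length ≤ B) (q : M.State) (i : ℕ) :
    ∃ i', Leads x s (mk (.run q) i n (fun t => frame (l t) (z t))
        ⟨c₀ :: lS, levels (k + 1)⟩ ⟨some .delim :: lP, bits bP⟩ ⟨some .delim :: lR, bits bR⟩ y)
      (mk (.resume (inputAt (Y k) (val bP))) i' n (fun t => frame (l t) (z t))
        ⟨c₀ :: lS, some (.caller q) :: levels k⟩ ⟨some .delim :: lP, bits bP⟩
        ⟨some .delim :: lR, bits bR⟩ y) := by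
  obtain ⟨i', h⟩ := hcall n (fun t => syms (z t).left ++ some .delim :: l t)
    (fun t => (z t).right) (some (.caller q)) (c₀ :: lS) lP lR bP bR y
    (min (Move.stay.apply i) (x.length + 1)) hn (by simp) hbPB
    (fun t => by have := hl t; have := hzB t; simp; omega) (by simp; omega) (by omega) (by omega)
  refine ⟨i', (leads_silent rfl (fun t => .done (hn t)) (fun t => .done ?_) (exec_put _ _ ?_)
    (.done ?_) (.done ?_)).trans h⟩
  · have := hl t; have := hzB t; simp [frame]; omega
  · simp; omega
  · simp; omega
  · simp; omega

omit [Finite α] in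
theorem read_eq {c : M.Cfg} {z : M.Tape → Zip M.Symbol}
    (hz : ∀ t, (z t).cell M.blank = c.work t) (hz' : ∀ t, (z t).left.length = c.workPos t)
    (l : M.Tape → List (Option (Sym M N))) :
    (fun t => decode M.blank (Zip.read none (frame (l t) (z t) : Tp M N))) =
      fun t => c.work t (c.workPos t) := by
  funext t
  rw [decode_frame, ← Zip.cell_left_length, hz, hz']

/-- A stored tape grows only if the head is on a cell not stored yet; hence its length stays within
the space bound of the simulated machine. -/
theorem length_act_cons {A : Type} (a : A) (v : Move) (z : Zip A) :
    (z.act List.cons a v).left.length + (z.act List.cons a v).right.length =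
      z.left.length + max z.right.length 1 := by
  obtain ⟨l, r⟩ := z
  cases v <;> cases l <;> cases r <;> simp [Zip.act] <;> omega

omit [Finite α] in
theorem inSegment_frame {l : List (Option (Sym M N))} {z : Zip M.Symbol} {k : ℕ}
    (h : z.left.length + z.right.length ≤ k) : InSegment l k (frame l z : Tp M N) :=
  ⟨syms z.left, syms z.right, rfl, solid_syms _, solid_syms _, by simpa using h⟩

/-- Induction along the rest of the run of `M` on `Y`. Here `tail` is the output still to come and
`val bR` the number of its letters to be skipped, so the answer is the symbol of `tail` at position
`val bR + 1`. -/
theorem leads_run {Y : List α} {B k : ℕ} {Ys : ℕ → List α} (hY : Ys k = Y)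
    (hcall : CallSpec M N x Ys B s k)
    (hspace : M.SpaceAtMost Y B) (hlen : Y.length + 2 < 2 ^ B)
    {n : N.Tape → Tp M N} (hn : ∀ t, (n t).left.length < s)
    {l : M.Tape → List (Option (Sym M N))} {c₀ : Option (Sym M N)}
    {lS lP lR : List (Option (Sym M N))} {y : List α}
    (hl : ∀ t, (l t).length + B + (k + 1) * (B + 2) + 1 < s)
    (hS : lS.length + k + 3 < s)
    (hP : lP.length + B + (k + 1) * (B + 2) + 1 < s)
    (hR : lR.length + B + (k + 1) * (B + 2) + 1 < s)
    {d : M.Cfg} (hd : M.step Y d = none) {c : M.Cfg}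
    (hcd : StateTransition.Reaches (M.step Y) c d)
    (hc : StateTransition.Reaches (M.step Y) M.init c)
    {tail : List α} (htail : d.output = c.output ++ tail) {z : M.Tape → Zip M.Symbol}
    (hz : ∀ t, (z t).cell M.blank = c.work t) (hz' : ∀ t, (z t).left.length = c.workPos t)
    (hzB : ∀ t, (z t).left.length + (z t).right.length ≤ B) {bP bR : List Bool}
    (hbP : val bP = c.inputPos) (hbP' : c.inputPos ≤ Y.length + 1) (hbPB : bP.length ≤ B)
    (hbRB : bR.length ≤ B) (i : ℕ) :
    ∃ i' m p r, Leads x s (mk (.run c.state) i n (fun t => frame (l t) (z t))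
        ⟨c₀ :: lS, levels (k + 1)⟩ ⟨some .delim :: lP, bits bP⟩ ⟨some .delim :: lR, bits bR⟩ y)
      (mk (.ret (inputAt tail (val bR + 1))) i' n m ⟨c₀ :: lS, levels (k + 1)⟩ p r y) ∧
      (∀ t, InSegment (l t) B (m t)) ∧ InSegment lP B p ∧ InSegment lR B r := by
  induction hcd using Relation.ReflTransGen.head_induction_on generalizing tail z bP bR i with
  | refl =>
    obtain ⟨i', h⟩ := leads_fetch hcall hn (y := y) (c₀ := c₀) hl hS hP hR hzB hbPB hbRB d.state i
    obtain rfl : tail = [] := by simpa using htail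
    refine ⟨min (Move.stay.apply i') (x.length + 1), _, _, _, h.trans ?_,
      fun t => inSegment_frame (hzB t), inSegment_bits hbPB,
      inSegment_bits hbRB⟩
    -- The run ends before the wanted letter is emitted: `tail` is empty, and the answer is the
    -- right end marker.
    have hnext : M.next d.state (inputAt (Ys k) (val bP)) (fun t => d.work t (d.workPos t)) =
        none := by
      rw [hbP, hY]
      exact Option.map_eq_none_iff.mp hd
    refine leads_silent (v := .stay) (on := fun _ => none) (om := fun _ => none)
      (oc := some (.put (some .level) .stay)) (op := none) (or := none) ?_ (fun t => .done (hn t))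
      (fun t => .done ?_) (exec_put _ _ ?_) (.done ?_) (.done ?_)
    · simp only [next, onTapes, read_cons, read_eq hz hz', hnext]
      simp [inputAt]
    · have := hl t; have := hzB t; simp [frame]; omega
    · simp; omega
    · simp; omega
    · simp; omega
  | @head c c₁ h1 h2 ih =>
    obtain ⟨i', h⟩ := leads_fetch hcall hn (y := y) (c₀ := c₀) hl hS hP hR hzB hbPB hbRB c.state i
    have h1' := h1
    simp only [step, Option.mem_def, Option.map_eq_some_iff] at h1'
    obtain ⟨a, ha, hca⟩ := h1'
    obtain ⟨e, he⟩ := output_prefix h2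
    have hnext : M.next c.state (inputAt (Ys k) (val bP)) (fun t => c.work t (c.workPos t)) =
        some a := by
      rw [hbP, hY, ha]
    obtain ⟨b', hb', hbv, hbl⟩ := exec_shift (M := M) (N := N) (s := s) (l := lP) a.moveInput
      (by rw [hbP]; exact hbP') hbPB hlen (by omega)
    rw [hbP, ← hbP, ← hY] at hb'
    have hc1 : StateTransition.Reaches (M.step Y) M.init c₁ := hc.tail h1
    have hpos : ∀ t, c.workPos t < B := fun t => hspace c hc t
    have hw : ∀ t, Exec micro s (some (.write (some (.sym (a.write t))) (a.moveWork t)))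
        (frame (l t) (z t)) (frame (l t) ((z t).act List.cons (a.write t) (a.moveWork t)) :
          Tp M N) := fun t => exec_write _ _ (by
      have := hl t; have := hpos t; rw [hz' t]; omega)
    have hlev : Exec micro s (some (.put (some .level) .stay))
        (⟨c₀ :: lS, some (.caller c.state) :: levels k⟩ : Tp M N) ⟨c₀ :: lS, levels (k + 1)⟩ := by
      simpa [Zip.act, List.replicate_succ] using exec_put (some .level) .stay (s := s)
        (z := (⟨c₀ :: lS, some (.caller c.state) :: levels k⟩ : Tp M N)) (by simp; omega)
    have hzB' : ∀ t, ((z t).act List.cons (a.write t) (a.moveWork t)).left.length +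
        ((z t).act List.cons (a.write t) (a.moveWork t)).right.length ≤ B := fun t => by
      refine (length_act_cons _ _ _).trans_le ?_
      have := hpos t; have := hzB t; have := hz' t; omega
    subst hca
    -- The skip counter is left open, since it is lowered only if this step emits a letter.
    have key := fun bR hbRB i => ih (tail := e) hc1 he.symm
      (z := fun t => (z t).act List.cons (a.write t) (a.moveWork t))
      (fun t => by rw [Zip.cell_act (fun _ _ _ => rfl), hz, hz'])
      (fun t => by rw [Zip.left_length_act, hz'])
      hzB' (bP := b') (bR := bR)
      (by rw [hbv, hbP]) (min_le_right _ _) hbl hbRB i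
    rw [htail, List.append_assoc, List.append_cancel_left_eq] at he
    cases hem : a.emit with
    | none =>
      rw [hem] at he
      obtain rfl : e = tail := by simpa using he
      obtain ⟨i'', m, p, r, hL, hrest⟩ := key bR hbRB
        (min (Move.stay.apply i') (x.length + 1))
      refine ⟨i'', m, p, r, h.trans ((leads_silent (v := .stay)
        (on := fun _ => none)
        (om := fun t => some (.write (some (.sym (a.write t))) (a.moveWork t)))
        (oc := some (.put (some .level) .stay)) (or := none) ?_ (fun t => .done (hn t)) hw hlev hb'
        (.done ?_)).trans hL), hrest⟩
      · simp only [next, onTapes, read_cons, read_eq hz hz', hnext, hem]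
      · simp; omega
    | some b =>
      rw [hem] at he
      obtain rfl : b :: e = tail := by simpa using he
      have hnx : ∀ (R : Tp M N), next M N (.resume (inputAt (Ys k) (val bP))) (inputAt x i')
          (fun t => (onTapes n (fun t => frame (l t) (z t))
            ⟨c₀ :: lS, some (.caller c.state) :: levels k⟩ ⟨some .delim :: lP, bits bP⟩
            R t).read none) = some ⟨.emitTest a.state b, .stay, onTapes (fun _ => none)
            (fun t => some (.write (some (.sym (a.write t))) (a.moveWork t)))
            (some (.put (some .level) .stay)) (shift (inputAt (Ys k) (val bP)) a.moveInput)
            (some .find), none⟩ := by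
        intro R
        simp only [next, onTapes, read_cons, read_eq hz hz', hnext, hem]
      have hms : ∀ t, (frame (l t) ((z t).act List.cons (a.write t) (a.moveWork t)) :
          Tp M N).left.length < s := fun t => (hw t).left_lt'
      -- At zero the emitted letter is the wanted one; otherwise it is dropped and counted.
      by_cases hv : val bR = 0
      · have hi : InputSymbol.letter b = inputAt (b :: e) (val bR + 1) := by rw [hv]; rfl
        have h3 : Leads x s (mk (.emitTest a.state b) _ n _ _ _ ⟨bits bR ++ some .delim :: lR, []⟩ y)
            _ := leads_silent (x := x) (i := min (Move.stay.apply i') (x.length + 1)) (y := y)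
            (q' := .ret (inputAt (b :: e) (val bR + 1))) (v := .stay) (on := fun _ => none)
            (om := fun _ => none) (oc := none) (op := none) (or := none) (by rw [← hi]; rfl)
            (fun t => .done (hn t)) (fun t => .done (hms t)) (.done hlev.left_lt')
            (.done hb'.left_lt') (.done (by simp; omega))
        refine ⟨_, _, _, _, h.trans ((leads_silent (hnx _) (fun t => .done (hn t)) hw hlev hb'
          (exec_find_of_zero (by omega) hv)).trans h3), fun t => inSegment_frame (hzB' t),
          inSegment_bits hbl, inSegment_bits' hbRB⟩
      · obtain ⟨b'', w, hf⟩ := exec_find_of_pos (A := M.Symbol) (B := N.Symbol) (Q := M.State)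
          (s := s) (l := lR) (b := bR) (by omega) hv
        have h3 : Leads x s (mk (.emitTest a.state b) _ n _ _ _ w y) _ :=
          leads_silent (x := x) (i := min (Move.stay.apply i') (x.length + 1)) (y := y)
            (q' := .run a.state) (v := .stay) (on := fun _ => none) (om := fun _ => none)
            (oc := none) (op := none) (by simp only [next, onTapes, hf.read])
            (fun t => .done (hn t)) (fun t => .done (hms t)) (.done hlev.left_lt')
            (.done hb'.left_lt') hf.dec
        obtain ⟨i'', m, p, r, hL, hrest⟩ := key b'' (hf.length.trans_le hbRB)
          (min (Move.stay.apply (min (Move.stay.apply i') (x.length + 1))) (x.length + 1))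
        refine ⟨i'', m, p, r, h.trans ((leads_silent (hnx _) (fun t => .done (hn t)) hw hlev hb'
          hf.find).trans (h3.trans ?_)), hrest⟩
        rw [hf.val] at hL
        obtain ⟨v', hv'⟩ := Nat.exists_eq_succ_of_ne_zero hv
        rw [hv'] at hL ⊢
        exact hL

/-- Induction on the level. The summand `(k + 1) * (B + 2)` in `CallSpec` allows each of the levels
`0, …, k` one segment of `B` cells, a delimiter and possibly a mark for an unvisited head cell. By
`hlen`, every head position fits into `B` bits. -/
theorem callSpec {Y : ℕ → List α} {B : ℕ} (hx : Y 0 = x)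
    (hout : ∀ k, M.Outputs (Y k) (Y (k + 1))) (hspace : ∀ k, M.SpaceAtMost (Y k) B)
    (hlen : ∀ k, (Y k).length + 2 < 2 ^ B) (k : ℕ) :
    CallSpec M N x Y B s k := by
  have base : ∀ k, (∀ j, k = j + 1 → CallSpec M N x Y B s j) → CallSpec M N x Y B s k := by
    intro k ih n l r c lS lP lR bP bR y i hn hc hbP hl hS hP hR
    have hk : (k + 1) * (B + 2) = k * (B + 2) + (B + 2) := by ring
    rw [hk] at hl hP hR
    have hpl : ∀ t, (pushed (l t) (r t) : List (Option (Sym M N))).length ≤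
        (l t).length + (r t).length + 1 := fun t => by rw [length_pushed]; omega
    have hmt : ∀ t, (⟨some .delim :: pushed (l t) (r t), []⟩ : Tp M N).left.length < s :=
      fun t => by have := hl t; have := hpl t; simp; omega
    obtain ⟨lP', hlP'⟩ : ∃ lP', lP' = (bits bP).reverse ++ some .delim :: lP := ⟨_, rfl⟩
    obtain ⟨lR', hlR'⟩ : ∃ lR', lR' = (bits bR).reverse ++ some .delim :: lR := ⟨_, rfl⟩
    have hlP : lP'.length = lP.length + bP.length + 1 := by rw [hlP']; simp; omega
    have hlR : lR'.length = lR.length + bR.length + 1 := by rw [hlR']; simp; omega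
    have hcS : (⟨c :: lS, levels k⟩ : Tp M N).left.length < s := by simp; omega
    have hPs : (⟨some .delim :: lP', []⟩ : Tp M N).left.length < s := by simp; omega
    have h1 : Leads x s (mk .call i n (fun t => ⟨l t, syms (r t)⟩) ⟨c :: lS, levels k⟩
        ⟨some .delim :: lP, bits bP⟩ ⟨some .delim :: lR, bits bR⟩ y)
        (mk .copy _ n (fun t => ⟨some .delim :: pushed (l t) (r t), []⟩) ⟨c :: lS, levels k⟩
        ⟨some .delim :: lP, bits bP⟩ ⟨some .delim :: lR', []⟩ y) :=
      leads_silent rfl (fun t => .done (hn t))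
        (fun t => exec_mark (by have := hl t; omega)) (.done hcS) (.done (by simp; omega))
        (hlR' ▸ exec_seek (fun e he => (solid_bits _ e he).1) (by simp; omega))
    obtain ⟨i₁, h2⟩ := leads_copy (x := x) (s := s) (n := n)
      (m := fun t => ⟨some .delim :: pushed (l t) (r t), []⟩) (c := ⟨c :: lS, levels k⟩)
      (u := some .delim :: lP) (v := some .delim :: lR') (b := bP) (y := y)
      (min (Move.stay.apply i) (x.length + 1)) hn hmt hcS (by simp; omega) (by simp; omega)
    have hput : Exec micro s (some (.put (some .delim) .right))
        (⟨(bits bP).reverse ++ some .delim :: lP, []⟩ : Tp M N) ⟨some .delim :: lP', bits []⟩ := by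
      rw [hlP']
      exact exec_put _ _ (by simp; omega)
    have hhome : Exec micro s (some .home)
        (⟨(bits bP).reverse ++ some .delim :: lR', []⟩ : Tp M N)
        ⟨some .delim :: lR', bits bP⟩ := by
      simpa using exec_home (s := s) (l := lR') (r := []) (solid_bits bP).reverse
        (by simp [Solid]) (by simp; omega)
    have h3 := leads_silent (x := x) (q := .copy) (i := i₁) (y := y) rfl (fun t => .done (hn t))
      (fun t => .done (hmt t)) (.done hcS) hput hhome
    have h123 := h1.trans (h2.trans h3)
    have hret := fun (a : InputSymbol α) (m : M.Tape → Tp M N) (p' r' : Tp M N) (i : ℕ)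
      (hm : ∀ t, InSegment (pushed (l t) (r t)) B (m t)) (hp : InSegment lP' B p')
      (hr : InSegment lR' B r') => leads_ret (x := x) (y := y) (a := a) (lS := lS) k i hn hm
        (hlP' ▸ hp) (hlR' ▸ hr) hc (fun t => by have := hl t; omega) (by omega) (by omega) (by omega)
    have hem : ∀ t, InSegment (pushed (l t) (r t)) B
        (⟨some .delim :: pushed (l t) (r t), []⟩ : Tp M N) :=
      fun t => inSegment_frame (z := ⟨[], []⟩) (by simp)
    -- Position `0` holds the left end marker at every level, so no run is needed. At a positive
    -- position, one less is the number of letters to skip.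
    by_cases hv : val bP = 0
    · have h4 := leads_silent (x := x) (i := min (Move.stay.apply i₁) (x.length + 1)) (q := .enter)
        (y := y) rfl (fun t => .done (hn t)) (fun t => .done (hmt t)) (.done hcS) (.done hPs)
        (exec_find_of_zero (l := lR') (b := bP) (by omega) hv)
      obtain ⟨i₂, h6⟩ := hret .leftEnd _ _ _
        (min (Move.stay.apply (min (Move.stay.apply
          (min (Move.stay.apply i₁) (x.length + 1))) (x.length + 1))) (x.length + 1))
        hem (inSegment_bits (b := []) (by simp)) (inSegment_bits' hbP)
      have h5 := leads_silent (x := x) (i := min (Move.stay.apply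
          (min (Move.stay.apply i₁) (x.length + 1))) (x.length + 1)) (q := .enterTest)
        (n := n) (m := fun t => ⟨some .delim :: pushed (l t) (r t), []⟩) (c := ⟨c :: lS, levels k⟩)
        (p := ⟨some .delim :: lP', []⟩) (r := ⟨bits bP ++ some .delim :: lR', []⟩)
        (y := y) rfl (fun t => .done (hn t)) (fun t => .done (hmt t)) (.done hcS) (.done hPs)
        (.done (by simp; omega))
      refine ⟨i₂, h123.trans (h4.trans (h5.trans ?_))⟩
      rw [hv]
      exact h6
    · obtain ⟨b', w, hf⟩ := exec_find_of_pos (A := M.Symbol) (B := N.Symbol) (Q := M.State)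
          (s := s) (l := lR') (b := bP) (by omega) hv
      have h4 := leads_silent (x := x) (i := min (Move.stay.apply i₁) (x.length + 1)) (q := .enter)
        (y := y) rfl (fun t => .done (hn t)) (fun t => .done (hmt t)) (.done hcS) (.done hPs)
        hf.find
      have hbl := hf.length
      have hbv := hf.val
      generalize min (Move.stay.apply (min (Move.stay.apply i₁) (x.length + 1)))
        (x.length + 1) = i₂ at h4
      cases k with
      | zero =>
        have h5 := leads_silent (x := x) (i := i₂) (q := .enterTest) (y := y) (q' := .rewind)
          (v := .stay) (n := n) (c := ⟨c :: lS, levels 0⟩)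
          (on := fun _ => none) (om := fun _ => none) (oc := none) (op := none)
          (by simp only [next, onTapes, hf.read]; rfl)
          (fun t => .done (hn t)) (fun t => .done (hmt t)) (.done hcS) (.done hPs) hf.dec
        have h6 := leads_rewind (x := x) (n := n) (y := y)
          (m := fun t => ⟨some .delim :: pushed (l t) (r t), []⟩) (c := ⟨c :: lS, levels 0⟩)
          (p := ⟨some .delim :: lP', []⟩) (r := ⟨some .delim :: lR', bits b'⟩)
          (min (Move.stay.apply i₂) (x.length + 1)) hn hmt hcS hPs (by simp; omega)
        obtain ⟨i₃, r', h7, hr'⟩ := leads_scan (x := x) (n := n) (y := y)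
          (m := fun t => ⟨some .delim :: pushed (l t) (r t), []⟩) (c := ⟨c :: lS, levels 0⟩)
          (p := ⟨some .delim :: lP', []⟩) (l := lR') (b := b') hn hmt hcS hPs
          (i := 1) (by omega) rfl (by omega)
        obtain ⟨i₄, h8⟩ := hret (inputAt x (1 + val b')) _ _ _ i₃ hem
          (inSegment_bits (b := []) (by simp)) (hr'.mono (by omega))
        refine ⟨i₄, h123.trans (h4.trans (h5.trans (h6.trans (h7.trans ?_))))⟩
        rw [hx, ← hbv, add_comm (val b')]
        exact h8
      | succ k =>
        have h5 := leads_silent (x := x) (i := i₂) (q := .enterTest) (y := y) (q' := .run M.start)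
          (v := .stay) (n := n) (c := ⟨c :: lS, levels (k + 1)⟩)
          (on := fun _ => none) (om := fun _ => none) (oc := none) (op := none)
          (by simp only [next, onTapes, hf.read]; rfl)
          (fun t => .done (hn t)) (fun t => .done (hmt t)) (.done hcS) (.done hPs) hf.dec
        obtain ⟨d, hd, hd', hdo⟩ := hout k
        obtain ⟨i₃, m', p', r', h6, hm', hp', hr'⟩ := leads_run (Y := Y k) (Ys := Y) (B := B) rfl
          (ih k rfl) (hspace k) (hlen k) (s := s) (n := n) hn
          (l := fun t => pushed (l t) (r t)) (c₀ := c) (lS := lS) (lP := lP') (lR := lR') (y := y)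
          (fun t => by have := hl t; have := hpl t; omega) (by omega) (by omega)
          (by omega) hd' hd .refl (tail := Y (k + 1)) (by simp [hdo, Transducer.init])
          (z := fun _ => ⟨[], []⟩) (fun t => by funext j; simp [Zip.cell, Transducer.init])
          (fun t => rfl) (by simp) (bP := []) (bR := b') rfl (by simp [Transducer.init]) (by simp)
          (by omega) (min (Move.stay.apply i₂) (x.length + 1))
        obtain ⟨i₄, h8⟩ := hret (inputAt (Y (k + 1)) (val b' + 1)) _ _ _ i₃ hm' hp' hr'
        refine ⟨i₄, h123.trans (h4.trans (h5.trans (h6.trans ?_)))⟩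
        rw [← hbv]
        exact h8
  induction k with
  | zero => exact base 0 (by simp)
  | succ k ih => exact base (k + 1) fun j hj => by cases hj; exact ih

/-! ### Computing the number of iterations and printing the result. -/

/-- The tape `z` of the transducer for the number of iterations. -/
def auxTape (z : Zip N.Symbol) : Tp M N :=
  ⟨z.left.map fun a => some (.aux a), z.right.map fun a => some (.aux a)⟩

omit [Finite α] in
theorem act_auxTape (a : N.Symbol) (v : Move) (z : Zip N.Symbol) :
    (auxTape z : Tp M N).act optCons (some (.aux a)) v = auxTape (z.act List.cons a v) := by
  obtain ⟨l, r⟩ := z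
  cases v <;> cases l <;> cases r <;> simp [auxTape, Zip.act]

omit [Finite α] in
theorem readAux_eq {c : N.Cfg} {z : N.Tape → Zip N.Symbol}
    (hz : ∀ t, (z t).cell N.blank = c.work t) (hz' : ∀ t, (z t).left.length = c.workPos t) :
    (fun t => decodeAux N.blank (Zip.read none (auxTape (z t) : Tp M N))) =
      fun t => c.work t (c.workPos t) := by
  funext t
  rw [← hz, ← hz', Zip.cell_left_length]
  obtain ⟨l, r⟩ := z t
  cases r <;> rfl

/-- `N` runs on the real input, and its output bits are collected on the tape `rem`, where they form
a counter at once because `Nat.bits` begins with the least significant bit. -/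
theorem leads_count {m : M.Tape → Tp M N} {cS p : Tp M N} {y : List α}
    (hm : ∀ t, (m t).left.length < s) (hcS : cS.left.length < s) (hp : p.left.length < s)
    {S : ℕ} (hspace : N.SpaceAtMost x S) (hS : S + 1 < s) {d : N.Cfg}
    (hd : N.step x d = none) (hds : d.output.length + 2 < s) {c : N.Cfg}
    (hcd : StateTransition.Reaches (N.step x) c d)
    (hc : StateTransition.Reaches (N.step x) N.init c) {z : N.Tape → Zip N.Symbol}
    (hz : ∀ t, (z t).cell N.blank = c.work t) (hz' : ∀ t, (z t).left.length = c.workPos t) :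
    ∃ i' n, Leads x s (mk (.count c.state) c.inputPos (fun t => auxTape (z t)) m cS p
        ⟨(bits c.output).reverse ++ [some .delim], []⟩ y)
      (mk .unary i' n m cS p ⟨[some .delim], bits d.output⟩ y) ∧
      ∀ t, (n t).left.length < s := by
  induction hcd using Relation.ReflTransGen.head_induction_on generalizing z with
  | refl =>
    have hn : ∀ t, (auxTape (z t) : Tp M N).left.length < s := fun t => by
      have := hspace d hc t
      simp [auxTape, hz']
      omega
    have hnext := Option.map_eq_none_iff.mp hd
    have hhome : Exec micro s (some .home)
        (⟨(bits d.output).reverse ++ [some .delim], []⟩ : Tp M N)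
        ⟨[some .delim], bits d.output⟩ := by
      simpa using exec_home (s := s) (l := []) (r := []) (solid_bits d.output).reverse
        (by simp [Solid]) (by simp; omega)
    refine ⟨_, _, leads_silent (v := .stay) (on := fun _ => none) (om := fun _ => none)
      (oc := none) (op := none) ?_ (fun t => .done (hn t)) (fun t => .done (hm t)) (.done hcS)
      (.done hp) hhome, hn⟩
    simp only [next, onTapes, readAux_eq hz hz', hnext]
  | @head c c₁ h1 h2 ih =>
    have h1' := h1
    simp only [step, Option.mem_def, Option.map_eq_some_iff] at h1'
    obtain ⟨a, ha, hca⟩ := h1'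
    have hlen := (output_prefix h2).length_le
    have hc1 : StateTransition.Reaches (N.step x) N.init c₁ := hc.tail h1
    have hw : ∀ t, Exec micro s (some (.put (some (.aux (a.write t))) (a.moveWork t)))
        (auxTape (z t) : Tp M N) (auxTape ((z t).act List.cons (a.write t) (a.moveWork t))) :=
      fun t => by
        rw [← act_auxTape]
        have := hspace c hc t
        exact exec_put _ _ (by simp [auxTape, hz']; omega)
    subst hca
    simp only [List.length_append] at hlen
    obtain ⟨i', n, h, hn⟩ := ih hc1
      (z := fun t => (z t).act List.cons (a.write t) (a.moveWork t))
      (fun t => by rw [Zip.cell_act (fun _ _ _ => rfl), hz, hz'])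
      (fun t => by rw [Zip.left_length_act, hz'])
    have hrem : Exec micro s (a.emit.map fun b => .put (some (.bit b)) .right)
        (⟨(bits c.output).reverse ++ [some .delim], []⟩ : Tp M N)
        ⟨(bits (c.output ++ a.emit.toList)).reverse ++ [some .delim], []⟩ := by
      cases a.emit with
      | none => simpa using Exec.done (by simp; omega)
      | some b =>
        have := exec_put (s := s) (some (.bit b)) .right
          (z := (⟨(bits c.output).reverse ++ [some .delim], []⟩ : Tp M N)) (by simp; omega)
        simpa [Zip.act] using this
    refine ⟨i', n, (leads_silent ?_ hw (fun t => .done (hm t)) (.done hcS)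
      (.done hp) hrem).trans h, hn⟩
    simp only [next, onTapes, readAux_eq hz hz', ha]

/-- The number of iterations is converted from binary to unary, one level mark each; this is
affordable because the number itself is logarithmic. What is left of the counter stays at the bottom
of `rem`, and only its length matters. -/
theorem leads_unary {n : N.Tape → Tp M N} {m : M.Tape → Tp M N} {p : Tp M N} {y : List α}
    {v : ℕ} (hn : ∀ t, (n t).left.length < s) (hm : ∀ t, (m t).left.length < s)
    (hp : p.left.length < s) (i k : ℕ) {b : List Bool} (hv : val b = v)
    (hb : b.length + 2 < s) (hk : k + v + 2 < s) :
    ∃ i' b', Leads x s (mk .unary i n m ⟨levels k ++ [some .delim], []⟩ p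
        ⟨[some .delim], bits b⟩ y)
      (mk .call i' n m ⟨[some .delim], levels (k + v)⟩ p ⟨[some .delim], bits b'⟩ y) ∧
      b'.length = b.length := by
  have hlev : (⟨levels k ++ [some .delim], []⟩ : Tp M N).left.length < s := by simp; omega
  induction v generalizing i k b with
  | zero =>
    have h1 := leads_silent (x := x) (i := i) (q := .unary) (y := y) rfl (fun t => .done (hn t))
      (fun t => .done (hm t)) (.done hlev) (.done hp)
      (exec_find_of_zero (l := []) (b := b) (by simp; omega) hv)
    have hsol : Solid (levels k : List (Option (Sym M N))) := by
      intro c hc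
      rw [List.eq_of_mem_replicate hc]
      simp
    have hhome : Exec micro s (some .home) (⟨levels k ++ [some .delim], []⟩ : Tp M N)
        ⟨[some .delim], levels k⟩ := by
      simpa using exec_home (s := s) (l := []) (r := []) hsol (by simp [Solid]) (by simp; omega)
    have hhome' : Exec micro s (some .home) (⟨bits b ++ [some .delim], []⟩ : Tp M N)
        ⟨[some .delim], bits b.reverse⟩ := by
      simpa [bits_reverse] using
        exec_home (s := s) (l := []) (r := []) (solid_bits b) (by simp [Solid]) (by simp; omega)
    exact ⟨_, b.reverse, h1.trans (leads_silent rfl (fun t => .done (hn t))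
      (fun t => .done (hm t)) hhome (.done hp) hhome'), by simp⟩
  | succ v ih =>
    obtain ⟨b', w, hf⟩ := exec_find_of_pos (A := M.Symbol) (B := N.Symbol) (Q := M.State)
      (s := s) (l := []) (b := b) (by simp; omega) (by omega)
    have h1 := leads_silent (x := x) (i := i) (q := .unary) (y := y) rfl (fun t => .done (hn t))
      (fun t => .done (hm t)) (.done hlev) (.done hp) hf.find
    have hput : Exec micro s (some (.put (some .level) .right))
        (⟨levels k ++ [some .delim], []⟩ : Tp M N) ⟨levels (k + 1) ++ [some .delim], []⟩ := by
      simpa [Zip.act, List.replicate_succ] using exec_put (some .level) .right (s := s)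
        (z := (⟨levels k ++ [some .delim], []⟩ : Tp M N)) (by simp; omega)
    have h2 := leads_silent (x := x) (i := min (Move.stay.apply i) (x.length + 1))
      (q := .unaryTest) (q' := .unary) (v := .stay) (on := fun _ => none) (om := fun _ => none)
      (op := none) (y := y) (by simp only [next, onTapes, hf.read]) (fun t => .done (hn t))
      (fun t => .done (hm t)) hput (.done hp) hf.dec
    obtain ⟨i', b'', h3, hb''⟩ := ih
      (min (Move.stay.apply (min (Move.stay.apply i) (x.length + 1))) (x.length + 1)) (k + 1)
      (b := b') (by have := hf.val; omega) (by rw [hf.length]; exact hb) (by omega)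
      (by simp; omega)
    refine ⟨i', b'', h1.trans (h2.trans ?_), hb''.trans hf.length⟩
    rw [show k + (v + 1) = k + 1 + v by omega]
    exact h3

/-- Positions `0, 1, …` of `Y k` are requested in turn until the right end marker appears; `j`
counts the remaining ones. The truncated `val b - 1` reflects that the left end marker prints
nothing. -/
theorem leads_output {Y : ℕ → List α} {B k : ℕ} (hcall : CallSpec M N x Y B s k)
    (hlen : (Y k).length + 2 < 2 ^ B) {n : N.Tape → Tp M N} (hn : ∀ t, (n t).left.length < s)
    {R : ℕ} {bR : List Bool} (hbR : bR.length ≤ R)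
    (hs : B + k + R + 3 + (k + 1) * (B + 2) < s) {j : ℕ} (i : ℕ) {b : List Bool}
    (hb : b.length ≤ B) (hj : val b + j = (Y k).length + 1) :
    ∃ c : (program M N).Cfg, Leads x s (mk .call i n (fun _ => ⟨[], []⟩)
        ⟨[some .delim], levels k⟩ ⟨[some .delim], bits b⟩ ⟨[some .delim], bits bR⟩
        ((Y k).take (val b - 1))) c ∧
      (program M N).next c.state (inputAt x c.inputPos) (fun t => (c.tapes t).read none) = none ∧
      (∀ t, (c.tapes t).left.length < s) ∧ c.output = Y k := by
  have hgo : ∀ (i : ℕ) (b : List Bool), b.length ≤ B → ∃ i',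
      Leads x s (mk .call i n (fun _ => ⟨[], []⟩)
        ⟨[some .delim], levels k⟩ ⟨[some .delim], bits b⟩ ⟨[some .delim], bits bR⟩
        ((Y k).take (val b - 1)))
      (mk (.resume (inputAt (Y k) (val b))) i' n (fun _ => ⟨[], []⟩)
        ⟨[], some .delim :: levels k⟩ ⟨[some .delim], bits b⟩ ⟨[some .delim], bits bR⟩
        ((Y k).take (val b - 1))) := fun i b hb =>
    hcall n (fun _ => []) (fun _ => []) (some .delim) [] [] [] b bR _ i hn (by simp) hb
      (fun t => by simp; omega) (by simp; omega) (by simp; omega) (by simp; omega)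
  have hmove : Exec micro s (some (.move .right)) (⟨[], some .delim :: levels k⟩ : Tp M N)
      ⟨[some .delim], levels k⟩ := exec_move _ (by simp; omega)
  induction j generalizing i b with
  | zero =>
    obtain ⟨i', h⟩ := hgo i b hb
    refine ⟨_, h, ?_, ?_, ?_⟩
    · rw [inputAt_eq_rightEnd.mpr (by omega)]
      rfl
    · rintro (t | t | _ | _ | _)
      exacts [hn t, (by omega : 0 < s), (by omega : 0 < s), (by omega : 1 < s),
        (by omega : 1 < s)]
    · exact List.take_of_length_le (by omega)
  | succ j ih =>
    obtain ⟨i', h⟩ := hgo i b hb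
    obtain ⟨b', hinc, hv, hl⟩ := exec_inc (A := M.Symbol) (B := N.Symbol) (Q := M.State)
      (s := s) (l := []) (b := b) (by simp; omega)
    have hb' := hl B hb (by omega)
    obtain ⟨c, hc, hc'⟩ := ih (min (Move.stay.apply i') (x.length + 1)) hb' (by omega)
    refine ⟨c, h.trans (Leads.trans ?_ hc), hc'⟩
    have hm : ∀ t : M.Tape, (⟨[], []⟩ : Tp M N).left.length < s := fun _ => by simp; omega
    cases hi : inputAt (Y k) (val b) with
    | leftEnd =>
      have h0 := inputAt_eq_leftEnd.mp hi
      have h1 := leads_silent (x := x) (i := i') (q := .resume .leftEnd) (n := n)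
        (m := fun _ => ⟨[], []⟩) (c := ⟨[], some .delim :: levels k⟩)
        (r := ⟨[some .delim], bits bR⟩)
        (y := (Y k).take (val b - 1)) rfl (fun t => .done (hn t))
        (fun t => .done (hm t)) hmove hinc (.done (by simp; omega))
      rw [hv]
      simpa [h0] using h1
    | rightEnd => have := inputAt_eq_rightEnd.mp hi; omega
    | letter a =>
      have h1 := leads_single (x := x) (i := i') (q := .resume (.letter a)) (n := n)
        (m := fun _ => ⟨[], []⟩) (c := ⟨[], some .delim :: levels k⟩)
        (r := ⟨[some .delim], bits bR⟩)
        (y := (Y k).take (val b - 1)) rfl (fun t => .done (hn t))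
        (fun t => .done (hm t)) hmove hinc (.done (by simp; omega))
      have ht : (Y k).take (val b' - 1) = (Y k).take (val b - 1) ++ [a] := by
        rw [hv]
        cases hvb : val b with
        | zero => rw [hvb] at hi; simp [inputAt] at hi
        | succ v =>
          rw [hvb] at hi
          simp only [inputAt] at hi
          split at hi
          · rename_i a' ha'
            cases hi
            simp [List.take_add_one, ha']
          · cases hi
      rw [ht]
      exact h1

theorem computes {Y : ℕ → List α} {B S k : ℕ} (hx : Y 0 = x)
    (hout : ∀ k, M.Outputs (Y k) (Y (k + 1))) (hspace : ∀ k, M.SpaceAtMost (Y k) B)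
    (hlen : ∀ k, (Y k).length + 2 < 2 ^ B) (hN : N.Outputs x k.bits) (hN' : N.SpaceAtMost x S)
    (hs : B + S + k + k.bits.length + 3 + (k + 1) * (B + 2) < s) :
    (program M N).toTransducer.Outputs x (Y k) ∧ (program M N).toTransducer.SpaceAtMost x s := by
  have hput : Exec micro s (some (.put (some .delim) .right)) (⟨[], []⟩ : Tp M N)
      ⟨[some .delim], []⟩ := exec_put _ _ (by simp; omega)
  have hm : ∀ t : M.Tape, (⟨[], []⟩ : Tp M N).left.length < s := fun _ => by simp; omega
  have h1 := leads_silent (x := x) (i := 0) (q := .start) (n := fun _ => ⟨[], []⟩)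
    (m := fun _ => ⟨[], []⟩) (y := []) rfl (fun t => .done (by simp; omega))
    (fun t => .done (hm t)) hput hput hput
  obtain ⟨d, hd, hd', hdo⟩ := hN
  obtain ⟨i₁, n, h2, hn⟩ := leads_count (M := M) (m := fun _ => ⟨[], []⟩)
    (cS := ⟨[some .delim], []⟩) (p := ⟨[some .delim], []⟩) (y := []) hm
    (by simp; omega) (by simp; omega) hN' (by omega) hd' (by rw [hdo]; omega) hd .refl
    (z := fun _ => ⟨[], []⟩) (fun t => by funext j; simp [Zip.cell, Transducer.init])
    (fun t => rfl)
  obtain ⟨i₂, b, h3, hb⟩ := leads_unary (x := x) (M := M) (m := fun _ => ⟨[], []⟩)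
    (p := ⟨[some .delim], []⟩) (y := []) hn hm
    (by simp; omega) i₁ 0 (b := d.output) (v := k) (by rw [hdo, val_bits]) (by rw [hdo]; omega)
    (by omega)
  obtain ⟨c, h4, hc, hc', hco⟩ := leads_output (b := []) (j := (Y k).length + 1)
    (callSpec (M := M) (N := N) (s := s) hx hout hspace hlen k)
    (hlen k) hn (R := k.bits.length) (bR := b) (by rw [hb, hdo]) (by omega) i₂ (by simp)
    (by simp [val])
  rw [zero_add] at h3
  have hreach : (program M N).Reach x s (program M N).init c := by
    have h0 : (program M N).init =
        mk .start 0 (fun _ => ⟨[], []⟩) (fun _ => ⟨[], []⟩) ⟨[], []⟩ ⟨[], []⟩ ⟨[], []⟩ [] := by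
      simp only [Program.init, mk]
      congr
      funext t
      cases t <;> rfl
    rw [h0]
    exact h1.trans (Leads.trans h2 (h3.trans h4))
  rw [← hco]
  exact hreach.computes hc hc'

end Iteration

end LogComp

/-! ### Logarithmic bounds and the theorem. -/

namespace LogComp

/-- The length of the binary representation of a natural number, at least one. -/
def logBound (n : ℕ) : ℕ := Nat.log 2 n + 1

theorem log_le_logBound (n : ℕ) : Real.log n ≤ logBound n := by
  rcases Nat.eq_zero_or_pos n with rfl | hn
  · simp [logBound]
  have h : (n : ℝ) ≤ 2 ^ logBound n := by exact_mod_cast (Nat.lt_pow_succ_log_self one_lt_two n).le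
  calc Real.log n ≤ Real.log (2 ^ logBound n) := Real.log_le_log (by exact_mod_cast hn) h
    _ = logBound n * Real.log 2 := Real.log_pow _ _
    _ ≤ logBound n * 1 := by
      gcongr
      exact (Real.log_two_lt_d9.le).trans (by norm_num)
    _ = logBound n := mul_one _

theorem logBound_isBigO : (fun n => (logBound n : ℝ)) =O[atTop] fun n : ℕ => Real.log n := by
  -- For `n ≥ 2`, both `Nat.log 2 n * log 2` and `log 2` are at most `log n`, and `2 / log 2 < 3`.
  refine IsBigO.of_bound (3 : ℝ) ?_
  filter_upwards [eventually_ge_atTop 2] with n hn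
  have h0 : (0 : ℝ) < n := by positivity
  have h : (2 : ℝ) ^ Nat.log 2 n ≤ n := by exact_mod_cast Nat.pow_log_le_self 2 (by omega)
  have h1 := Real.log_le_log (by positivity) h
  rw [Real.log_pow] at h1
  have h2 := Real.log_le_log two_pos (by exact_mod_cast hn : (2 : ℝ) ≤ n)
  have h3 := Real.log_two_gt_d9
  rw [Real.norm_of_nonneg (by positivity), Real.norm_of_nonneg (by linarith), logBound]
  push_cast
  nlinarith [Nat.cast_nonneg (α := ℝ) (Nat.log 2 n)]

/-- A quantity that is `O(log n)` is bounded by a multiple of `logBound n` for all `n`, if it is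
bounded for every `n`. -/
theorem exists_le_mul_logBound {ι : Type} {len : ι → ℕ} {h : ι → ℕ}
    (hfin : ∀ n, {a | len a < n}.Finite)
    (hO : (fun a => (h a : ℝ)) =O[comap len atTop] fun a => Real.log (len a)) :
    ∃ c : ℕ, ∀ a, h a ≤ c * logBound (len a) := by
  obtain ⟨C, hC⟩ := hO.bound
  obtain ⟨n, hn⟩ := eventually_atTop.mp (eventually_comap.mp hC)
  -- The asymptotic bound fails to cover only finitely many arguments. There the constant `D`
  -- suffices, as `logBound` is at least one, even where the logarithm vanishes.
  obtain ⟨D, hD⟩ := ((hfin n).image h).bddAbove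
  refine ⟨max D ⌈C⌉₊, fun a => ?_⟩
  by_cases ha : len a < n
  · calc h a ≤ D := hD ⟨a, ha, rfl⟩
      _ ≤ max D ⌈C⌉₊ * 1 := by simp
      _ ≤ _ := Nat.mul_le_mul_left _ (by simp [logBound])
  · have h1 := hn (len a) (by omega) a rfl
    rw [Real.norm_natCast, Real.norm_of_nonneg (Real.log_natCast_nonneg _)] at h1
    have h2 : (h a : ℝ) ≤ (max D ⌈C⌉₊ : ℕ) * logBound (len a) :=
      calc (h a : ℝ) ≤ C * Real.log (len a) := h1
        _ ≤ (max D ⌈C⌉₊ : ℕ) * Real.log (len a) := by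
          refine mul_le_mul_of_nonneg_right ?_ (Real.log_natCast_nonneg _)
          exact (Nat.le_ceil C).trans (by exact_mod_cast le_max_right _ _)
        _ ≤ _ := by gcongr; exact log_le_logBound _
    exact_mod_cast h2

theorem exists_le_mul_logBound_nat {h : ℕ → ℕ}
    (hO : (fun n => (h n : ℝ)) =O[atTop] fun n : ℕ => Real.log n) :
    ∃ c : ℕ, ∀ n, h n ≤ c * logBound n :=
  exists_le_mul_logBound (len := id) (fun n => Set.finite_lt_nat n) (by rw [comap_id]; exact hO)

theorem logBound_mono {m n : ℕ} (h : m ≤ n) : logBound m ≤ logBound n :=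
  Nat.add_le_add_right (Nat.log_mono_right h) 1

/-- The logarithm of a polynomial is bounded by a multiple of the logarithm. -/
theorem exists_logBound_eval_le (γ : Polynomial ℕ) :
    ∃ c : ℕ, ∀ n, logBound (γ.eval n + n + 2) ≤ c * logBound n := by
  obtain ⟨e, he⟩ : ∃ e, ∀ n, γ.eval n ≤ 2 ^ (e * logBound n) := by
    induction γ using Polynomial.induction_on' with
    | add p q hp hq =>
      obtain ⟨a, ha⟩ := hp
      obtain ⟨b, hb⟩ := hq
      refine ⟨a + b + 1, fun n => ?_⟩
      have h1 : 1 ≤ logBound n := by simp [logBound]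
      rw [Polynomial.eval_add]
      calc _ ≤ 2 ^ (a * logBound n) + 2 ^ (b * logBound n) := Nat.add_le_add (ha n) (hb n)
        _ ≤ 2 ^ ((a + b) * logBound n) + 2 ^ ((a + b) * logBound n) := by
          gcongr <;> omega
        _ = 2 ^ ((a + b) * logBound n + 1) := by ring
        _ ≤ _ := by
          refine Nat.pow_le_pow_right two_pos ?_
          rw [add_mul _ 1]
          omega
    | monomial k a =>
      refine ⟨a + k, fun n => ?_⟩
      have h1 : 1 ≤ logBound n := by simp [logBound]
      rw [Polynomial.eval_monomial, add_mul, pow_add]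
      refine Nat.mul_le_mul (Nat.lt_two_pow_self.le.trans
        (Nat.pow_le_pow_right two_pos (Nat.le_mul_of_pos_right _ h1))) ?_
      rw [mul_comm, pow_mul]
      exact Nat.pow_le_pow_left (Nat.lt_pow_succ_log_self one_lt_two n).le k
  refine ⟨e + 4, fun n => ?_⟩
  have h1 : 1 ≤ logBound n := by simp [logBound]
  have h2 : n < 2 ^ logBound n := Nat.lt_pow_succ_log_self one_lt_two n
  -- With `u = 2 ^ (e * logBound n) ≥ 1` and `v = 2 ^ logBound n ≥ 2`, the left side is less than `u
  -- + v + 2`, which three factors `v` next to `u` absorb.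
  have h3 : γ.eval n + n + 2 < 2 ^ ((e + 3) * logBound n) := by
    have h4 : 1 ≤ 2 ^ (e * logBound n) := Nat.one_le_two_pow
    have h5 : 2 ≤ 2 ^ logBound n := by
      calc 2 = 2 ^ 1 := rfl
        _ ≤ _ := Nat.pow_le_pow_right two_pos h1
    have h6 := he n
    have : 2 ^ ((e + 3) * logBound n) =
        2 ^ (e * logBound n) * (2 ^ logBound n * 2 ^ logBound n * 2 ^ logBound n) := by ring
    rw [this]
    generalize 2 ^ (e * logBound n) = u at *
    generalize 2 ^ logBound n = v at *
    have h7 : 2 * v ≤ v * v := Nat.mul_le_mul_right _ h5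
    have h8 : 2 * (v * v) ≤ v * v * v := by nlinarith
    have h9 : u * (4 * v) ≤ u * (v * v * v) := Nat.mul_le_mul_left _ (by omega)
    nlinarith
  have h4 := Nat.log_lt_of_lt_pow (by omega) h3
  rw [logBound]
  calc _ ≤ (e + 3) * logBound n := h4
    _ ≤ _ := Nat.mul_le_mul_right _ (by omega)

theorem logCompositions_subset (α : Type) [Fintype α] :
    logCompositions (polClass (FDSPACE α α (fun n => Real.log n))) ⊆
      FDSPACE α α (fun n => Real.log n ^ 2) := by
  rintro _ ⟨f, ⟨⟨M, sM, hsM, hM⟩, γ, hγ⟩, ρ, ⟨hρ, N, sN, hsN, hN⟩, rfl⟩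
  obtain ⟨cM, hcM⟩ := exists_le_mul_logBound_nat hsM
  obtain ⟨cN, hcN⟩ := exists_le_mul_logBound_nat hsN
  obtain ⟨r, hr⟩ := exists_le_mul_logBound (fun n => List.finite_length_lt α n) hρ
  obtain ⟨e, he⟩ := exists_logBound_eval_le γ
  -- The summand `x.length` covers `k = 0`, for which `γ` gives no bound.
  have hlen : ∀ x k, (f^[k] x).length ≤ γ.eval x.length + x.length := fun x k => by
    cases k with
    | zero => simp
    | succ k => exact (hγ x (k + 1) (by omega)).trans (Nat.le_add_right _ _)
  -- `cM * e` accounts for the space of `M` on the intermediate words, `e` for counters up to their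
  -- lengths.
  obtain ⟨b, hb⟩ : ∃ b, b = cM * e + e := ⟨_, rfl⟩
  refine ⟨(Iteration.program M N).toTransducer,
    -- The product bounds the stack: at most `(r + 1) * logBound n` levels of at most `(b + 2) *
    -- logBound n` cells. The other summands are for terms linear in `logBound n`, with `r` once for
    -- `ρ x` and once for its number of bits.
    fun n => (b + cN + r + r + 4 + (r + 1) * (b + 2)) * logBound n ^ 2, ?_, fun x => ?_⟩
  · simp only [Nat.cast_mul, Nat.cast_pow]
    exact (logBound_isBigO.pow 2).const_mul_left _
  · have h1 : 1 ≤ logBound x.length := by simp [logBound]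
    refine Iteration.computes (Y := fun k => f^[k] x) (B := b * logBound x.length)
      (S := cN * logBound x.length) (k := ρ x) rfl (fun k => ?_) (fun k c hc t => ?_) (fun k => ?_)
      (hN x).1 (fun c hc t => ((hN x).2 c hc t).trans_le (hcN _)) ?_
    · rw [Function.iterate_succ_apply']
      exact (hM _).1
    · refine ((hM _).2 c hc t).trans_le ((hcM _).trans ?_)
      calc cM * logBound (f^[k] x).length ≤ cM * (e * logBound x.length) :=
            Nat.mul_le_mul_left _ ((logBound_mono (by have := hlen x k; omega)).trans (he _))
        _ = cM * e * logBound x.length := by ring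
        _ ≤ _ := Nat.mul_le_mul_right _ (by omega)
    · calc (f^[k] x).length + 2 ≤ γ.eval x.length + x.length + 2 := by
            have := hlen x k; omega
        _ < 2 ^ logBound (γ.eval x.length + x.length + 2) :=
          Nat.lt_pow_succ_log_self one_lt_two _
        _ ≤ _ := Nat.pow_le_pow_right two_pos
          ((he _).trans (Nat.mul_le_mul_right _ (by omega)))
    · have h2 : (ρ x).bits.length ≤ ρ x := by
        rw [Nat.size_eq_bits_len, Nat.size_le]
        exact Nat.lt_two_pow_self
      have h3 := hr x
      show _ < (b + cN + r + r + 4 + (r + 1) * (b + 2)) * logBound x.length ^ 2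
      generalize logBound x.length = L at *
      have h4 : L ≤ L ^ 2 := by nlinarith
      have h5 : (ρ x + 1) * (b * L + 2) ≤ (r + 1) * (b + 2) * L ^ 2 := by
        calc _ ≤ ((r + 1) * L) * ((b + 2) * L) := Nat.mul_le_mul (by nlinarith) (by nlinarith)
          _ = _ := by ring
      have h6 : (b + cN + r + r + 4) * L ≤ (b + cN + r + r + 4) * L ^ 2 :=
        Nat.mul_le_mul_left _ h4
      rw [add_mul _ ((r + 1) * (b + 2))]
      nlinarith

end LogComp

theorem lemma1 (α : Type) [Fintype α] :
    LogComp.logCompositions (LogComp.polClass (LogComp.FDSPACE α α (fun n => Real.log n))) ⊆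
      LogComp.FDSPACE α α (fun n => Real.log n ^ 2) := by
  exact LogComp.logCompositions_subset α
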